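/- For a finite simple graph $G$ and a positive integer $d$ not exceeding the size of a maximum matching of $G$, a $d$-transversal set of $G$ is a set $T\subseteq E(G)$ with $|T\cap M|\ge d$ for every maximum matching $M$ of $G$ (a matching of the largest possible cardinality), and $\tau_d(G)$ denotes the smallest cardinality of a $d$-transversal set of $G$. For integers $m,n\ge 3$ let $C_m\square C_n$ be the toroidal grid, that is, the Cartesian product of the cycles with $m$ and $n$ vertices. **Theorem.** Let $m,n\ge 3$ be integers. 1. If $m$ and $n$ are even, then $\tau_d(C_m\square C_n)=4d$ for all integers $1\le d\le \frac{mn}{2}$. 2. If $m$ is even and $n$ is odd, then $\tau_d(C_m\square C_n)=4d$ for all integers $1\le d\le \frac{mn}{2}$. 3. If $m$ and $n$ are odd, then: (a) if $m\ge 5$, then $\tau_1(C_m\square C_n)=7$; (b) $4d+2\le \tau_d(C_m\square C_n)\le 5d+2$ for all integers $2\le d\le \frac{m-3}{2}$; (c) if $m\ge n$, then $\tau_d(C_m\square C_n)=4d+2$ for all integers $\frac{m-1}{2}\le d\le \frac{mn-1}{2}$. -/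

import Mathlib

/-- A finite set `M` of edges of `G` is a matching if no two distinct edges in `M` share an
endpoint. -/
def IsEdgeMatching {V : Type*} (G : SimpleGraph V) (M : Finset (Sym2 V)) : Prop :=
  (∀ e ∈ M, e ∈ G.edgeSet) ∧
    ∀ e ∈ M, ∀ f ∈ M, e ≠ f → ∀ v : V, v ∈ e → v ∉ f

/-- A matching is maximum if its cardinality is the largest among all matchings. -/
def IsMaximumMatching {V : Type*} (G : SimpleGraph V) (M : Finset (Sym2 V)) : Prop :=
  IsEdgeMatching G M ∧ ∀ N : Finset (Sym2 V), IsEdgeMatching G N → N.card ≤ M.card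

/-- A set `T` of edges of `G` is a `d`-transversal set if it contains at least `d` edges of every
maximum matching of `G`. -/
def IsTransversalSet {V : Type*} [DecidableEq V] (G : SimpleGraph V) (d : ℕ)
    (T : Finset (Sym2 V)) : Prop :=
  (∀ e ∈ T, e ∈ G.edgeSet) ∧
    ∀ M : Finset (Sym2 V), IsMaximumMatching G M → d ≤ (T ∩ M).card

/-- The `d`-transversal number of a finite graph `G`: the smallest cardinality of a `d`-transversal
set. When `d` is at most the matching number, the set of all edges is `d`-transversal, so this is
an attained minimum. -/
noncomputable def transversalNumber {V : Type*} [DecidableEq V] (G : SimpleGraph V) (d : ℕ) : ℕ :=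
  sInf {k : ℕ | ∃ T : Finset (Sym2 V), IsTransversalSet G d T ∧ T.card = k}

/-- The toroidal grid: the Cartesian product of the cycles with `m` and `n` vertices. -/
def toroidalGrid (m n : ℕ) : SimpleGraph (Fin m × Fin n) :=
  SimpleGraph.boxProd (SimpleGraph.cycleGraph m) (SimpleGraph.cycleGraph n)

/-!
Write `ν = ⌊m * n / 2⌋` for the size of a maximum matching of `C_m □ C_n`, a 4-regular graph with
`2 * m * n` edges.

Upper bounds. The edges at an independent set `A` meet every matching in at most `|A|` edges, and
every maximum matching in at least `|A|` edges, or in at least `|A| - 1` edges if the order is odd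
and one vertex is missed. So the edges at `A`, and also the edges avoiding `A`, form transversal
sets of known size (`isTransversalSet_edgesMeeting`, `exists_isTransversalSet_compl`). Large
independent sets come from shifting `{0, 2, 4, ...}` in each row along a closed walk of `m` steps
in the cycle of length `n` (`exists_independent_of_walk`). For `d = 1` and odd order, the seven edges
at two adjacent vertices suffice.

Lower bounds. For even `m` the edges decompose into four perfect matchings
(`exists_colouring_of_even`), and a transversal set has `d` edges in each of them. For odd `m` and
`n`, let `e` be an edge of some row and `f` an edge of some column. Then the edges other than `e` and
`f` decompose into four maximum matchings (`isMaximumMatching_odd`). If `e` and `f` can be taken in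
the transversal set `T`, this gives `|T| ≥ 4 * d + 2`. If `T` lies in the columns only, one compares
the colour classes of two translates of such a decomposition, and similarly for the rows
(`IsTransversalSet.add_two_le_of_odd_of_odd`).

For `d = 1` the bound `7` comes from Tutte's theorem. If six edges `T` meet all near-perfect
matchings, then there is a set `S` of vertices such that `C_m □ C_n`, without `S` and `T`, has at
least `|S| + 3` components. Each of them has at least four boundary edges, and all of them together
have at most `4 * |S| + 2 * |T|`. Equality throughout makes the components single vertices and `S`
an independent set of `(m * n - 3) / 2` vertices, which is impossible for `m ≥ 5` (`not_barrier`).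
-/

open Finset

/-! ### Matchings and transversal sets in finite graphs -/

theorem IsTransversalSet.transversalNumber_le {V : Type*} [DecidableEq V]
    {G : SimpleGraph V} {d k : ℕ} {T : Finset (Sym2 V)}
    (hT : IsTransversalSet G d T) (hk : T.card ≤ k) : transversalNumber G d ≤ k := by
  unfold transversalNumber
  exact le_trans (Nat.sInf_le ⟨T, hT, rfl⟩) hk

theorem le_transversalNumber {V : Type*} [DecidableEq V] {G : SimpleGraph V} {d k : ℕ}
    (hex : ∃ T, IsTransversalSet G d T)
    (h : ∀ T, IsTransversalSet G d T → k ≤ T.card) : k ≤ transversalNumber G d := by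
  obtain ⟨T, hT⟩ := hex
  refine le_csInf ⟨_, T, hT, rfl⟩ ?_
  rintro _ ⟨S, hS, rfl⟩
  exact h S hS

/-- Four matchings of total size `4 * ν`, where `ν` bounds the size of every matching, are all
maximum. -/
theorem isMaximumMatching_of_sum_card {V : Type*} {G : SimpleGraph V} {ν : ℕ}
    (hν : ∀ N, IsEdgeMatching G N → N.card ≤ ν)
    {F : ℕ → Finset (Sym2 V)} (hF : ∀ k < 4, IsEdgeMatching G (F k))
    (hsum : 4 * ν ≤ ∑ k ∈ range 4, (F k).card) {k : ℕ} (hk : k < 4) :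
    IsMaximumMatching G (F k) ∧ (F k).card = ν := by
  have h0 := hν _ (hF 0 (by omega))
  have h1 := hν _ (hF 1 (by omega))
  have h2 := hν _ (hF 2 (by omega))
  have h3 := hν _ (hF 3 (by omega))
  simp only [sum_range_succ, sum_range_zero] at hsum
  have h : (F k).card = ν := by
    interval_cases k <;> omega
  exact ⟨⟨hF k hk, fun N hN => (hν N hN).trans h.ge⟩, h⟩

section General

variable {V : Type*} [Fintype V] [DecidableEq V] {G : SimpleGraph V}

/-- The edges of `G` with an endpoint in `A`. -/
def edgesMeeting (G : SimpleGraph V) [DecidableRel G.Adj] (A : Finset V) : Finset (Sym2 V) :=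
  A.biUnion fun v => G.incidenceFinset v

theorem mem_edgesMeeting [DecidableRel G.Adj] {A : Finset V} {e : Sym2 V} :
    e ∈ edgesMeeting G A ↔ e ∈ G.edgeSet ∧ ∃ v ∈ A, v ∈ e := by
  simp only [edgesMeeting, mem_biUnion, SimpleGraph.mem_incidenceFinset, SimpleGraph.incidenceSet,
    Set.mem_sep_iff]
  tauto

theorem IsEdgeMatching.two_mul_card_eq {V : Type*} [DecidableEq V] {G : SimpleGraph V}
    {M : Finset (Sym2 V)} (hM : IsEdgeMatching G M) :
    2 * M.card = (M.biUnion Sym2.toFinset).card := by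
  rw [card_biUnion, sum_congr rfl (g := fun _ => 2), sum_const, smul_eq_mul, mul_comm]
  · intro e he
    exact Sym2.card_toFinset_of_not_isDiag _ (G.not_isDiag_of_mem_edgeSet (hM.1 e he))
  · intro e he f hf hef
    refine disjoint_left.2 fun v hv hv' => ?_
    rw [Sym2.mem_toFinset] at hv hv'
    exact hM.2 e he f hf hef v hv hv'

theorem IsEdgeMatching.two_mul_card_le {M : Finset (Sym2 V)} (hM : IsEdgeMatching G M) :
    2 * M.card ≤ Fintype.card V :=
  hM.two_mul_card_eq.trans_le (card_le_univ _)

/-- The number of vertices missed by a matching bounds the loss when the vertices of `A` are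
assigned to distinct matching edges. -/
theorem IsEdgeMatching.card_add_two_mul_card_le [DecidableRel G.Adj] {A : Finset V}
    {M : Finset (Sym2 V)} (hA : ∀ u ∈ A, ∀ v ∈ A, ¬ G.Adj u v) (hM : IsEdgeMatching G M) :
    A.card + 2 * M.card ≤ (edgesMeeting G A ∩ M).card + Fintype.card V := by
  rw [hM.two_mul_card_eq]
  set C := M.biUnion Sym2.toFinset with hC
  have h1 : (A ∩ C).card ≤ (edgesMeeting G A ∩ M).card := by
    refine card_le_card_of_forall_subsingleton (fun v e => v ∈ e) ?_ ?_
    · intro v hv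
      rw [mem_inter, hC, mem_biUnion] at hv
      obtain ⟨hvA, e, he, hve⟩ := hv
      rw [Sym2.mem_toFinset] at hve
      exact ⟨e, mem_inter.2 ⟨mem_edgesMeeting.2 ⟨hM.1 e he, v, hvA, hve⟩, he⟩, hve⟩
    · intro e he u hu v hv
      by_contra huv
      have hue := hu.2
      have hve := hv.2
      have hs := (Sym2.mem_and_mem_iff huv).1 ⟨hue, hve⟩
      have := hM.1 e (mem_inter.1 he).2
      rw [hs, SimpleGraph.mem_edgeSet] at this
      exact hA u (mem_inter.1 hu.1).1 v (mem_inter.1 hv.1).1 this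
  have h2 := card_union_add_card_inter A C
  have h3 : (A ∪ C).card ≤ Fintype.card V := card_le_univ _
  omega

theorem IsEdgeMatching.card_edgesMeeting_inter_le [DecidableRel G.Adj] {A : Finset V}
    {M : Finset (Sym2 V)} (hM : IsEdgeMatching G M) :
    (edgesMeeting G A ∩ M).card ≤ A.card := by
  refine card_le_card_of_forall_subsingleton (fun e v => v ∈ e) ?_ ?_
  · intro e he
    exact (mem_edgesMeeting.1 (mem_inter.1 he).1).2
  · intro v _ e he f hf
    by_contra hef
    exact hM.2 e (mem_inter.1 he.1).2 f (mem_inter.1 hf.1).2 hef v he.2 hf.2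

/-- The edges at an independent set `A` form a transversal set: a maximum matching has a separate
edge at every vertex of `A` that it covers. -/
theorem isTransversalSet_edgesMeeting [DecidableRel G.Adj] {A : Finset V} {d ν : ℕ}
    (hA : ∀ u ∈ A, ∀ v ∈ A, ¬ G.Adj u v) (hν : ∀ M, IsMaximumMatching G M → ν ≤ M.card)
    (hd : d + Fintype.card V ≤ A.card + 2 * ν) :
    IsTransversalSet G d (edgesMeeting G A) := by
  refine ⟨fun e he => (mem_edgesMeeting.1 he).1, fun M hM => ?_⟩
  have h1 := hM.1.card_add_two_mul_card_le hA
  have h2 := hν M hM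
  omega

theorem card_edgesMeeting_le [DecidableRel G.Adj] (hG : G.IsRegularOfDegree 4)
    (A : Finset V) : (edgesMeeting G A).card ≤ 4 * A.card := by
  refine card_biUnion_le.trans (le_of_eq ?_)
  rw [sum_congr rfl (g := fun _ => 4), sum_const, smul_eq_mul, mul_comm]
  intro v _
  rw [SimpleGraph.card_incidenceFinset_eq_degree, hG v]

theorem card_edgesMeeting [DecidableRel G.Adj] (hG : G.IsRegularOfDegree 4)
    {A : Finset V} (hA : ∀ u ∈ A, ∀ v ∈ A, ¬ G.Adj u v) :
    (edgesMeeting G A).card = 4 * A.card := by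
  rw [edgesMeeting, card_biUnion, sum_congr rfl (g := fun _ => 4), sum_const, smul_eq_mul, mul_comm]
  · intro v _
    rw [SimpleGraph.card_incidenceFinset_eq_degree, hG v]
  · intro u hu v hv huv
    refine disjoint_left.2 fun e he he' => ?_
    rw [SimpleGraph.mem_incidenceFinset] at he he'
    have := G.incidenceSet_inter_incidenceSet_of_not_adj (hA u hu v hv) huv
    exact (Set.mem_empty_iff_false e).1 (this ▸ ⟨he, he'⟩)

/-- The edges avoiding an independent set `A` form a transversal set: a maximum matching has at
most one edge at each vertex of `A`. -/
theorem exists_isTransversalSet_compl [DecidableRel G.Adj] (hG : G.IsRegularOfDegree 4)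
    {A : Finset V} {d ν : ℕ} (hA : ∀ u ∈ A, ∀ v ∈ A, ¬ G.Adj u v)
    (hν : ∀ M, IsMaximumMatching G M → ν ≤ M.card) (hd : d + A.card ≤ ν) :
    ∃ T, IsTransversalSet G d T ∧ T.card + 4 * A.card = 2 * Fintype.card V := by
  have hsub : edgesMeeting G A ⊆ G.edgeFinset :=
    biUnion_subset.2 fun v _ => G.incidenceFinset_subset v
  refine ⟨G.edgeFinset \ edgesMeeting G A, ⟨fun e he => ?_, fun M hM => ?_⟩, ?_⟩
  · exact SimpleGraph.mem_edgeFinset.1 (mem_sdiff.1 he).1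
  · have h1 := hM.1.card_edgesMeeting_inter_le (A := A)
    have h2 := hν M hM
    have h3 : (G.edgeFinset \ edgesMeeting G A) ∩ M =
        M \ edgesMeeting G A := by
      ext e
      simp only [mem_inter, mem_sdiff, SimpleGraph.mem_edgeFinset]
      exact ⟨fun h => ⟨h.2, h.1.2⟩, fun h => ⟨⟨hM.1.1 e h.1, h.2⟩, h.1⟩⟩
    rw [h3]
    have h4 := card_sdiff_add_card_inter M (edgesMeeting G A)
    rw [inter_comm M] at h4
    omega
  · have h1 := card_sdiff_add_card_inter G.edgeFinset (edgesMeeting G A)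
    rw [inter_eq_right.2 hsub, card_edgesMeeting hG hA] at h1
    have h2 := G.sum_degrees_eq_twice_card_edges
    rw [sum_congr rfl (fun v _ => hG v), sum_const, smul_eq_mul, card_univ] at h2
    omega

end General

/-! ### The edges of the toroidal grid -/

section Torus

variable {m n : ℕ} [NeZero m] [NeZero n]

/-- The edge joining the vertex `v` to its successor in the second coordinate. -/
def hEdge (v : Fin m × Fin n) : Sym2 (Fin m × Fin n) := s(v, (v.1, v.2 + 1))

/-- The edge joining the vertex `v` to its successor in the first coordinate. -/
def vEdge (v : Fin m × Fin n) : Sym2 (Fin m × Fin n) := s(v, (v.1 + 1, v.2))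

theorem Fin.val_one_of_two_le (hn : 2 ≤ n) : (1 : Fin n).val = 1 := by
  rw [Fin.val_one', Nat.mod_eq_of_lt (by omega)]

theorem Fin.add_one_ne_self (hn : 2 ≤ n) (x : Fin n) : x + 1 ≠ x := by
  rw [Ne, add_eq_left, Fin.ext_iff, Fin.val_one_of_two_le hn]
  simp

theorem Fin.add_one_add_one_ne_self (hn : 3 ≤ n) (x : Fin n) : x + 1 + 1 ≠ x := by
  rw [Ne, add_assoc, add_eq_left, Fin.ext_iff, Fin.val_add, Fin.val_one_of_two_le (by omega),
    Nat.mod_eq_of_lt (by omega)]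
  simp

theorem Fin.val_sub_one_cases (hn : 2 ≤ n) (x : Fin n) :
    (x - 1).val + 1 = x.val ∨ x.val = 0 ∧ (x - 1).val + 1 = n := by
  have h1 := Fin.val_one_of_two_le hn
  have h := x.2
  rw [Fin.sub_def, h1]
  rcases Nat.eq_zero_or_pos x.val with h0 | h0
  · right
    refine ⟨h0, ?_⟩
    simp only [h0]
    rw [Nat.mod_eq_of_lt (by omega)]
    omega
  · left
    simp only
    rw [show n - 1 + x.val = (x.val - 1) + n by omega, Nat.add_mod_right,
      Nat.mod_eq_of_lt (by omega)]
    omega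

theorem cycleGraph_adj_iff (hn : 2 ≤ n) {x y : Fin n} :
    (SimpleGraph.cycleGraph n).Adj x y ↔ y = x + 1 ∨ x = y + 1 := by
  obtain ⟨k, rfl⟩ : ∃ k, n = k + 2 := ⟨n - 2, by omega⟩
  rw [SimpleGraph.cycleGraph_adj, sub_eq_iff_eq_add', sub_eq_iff_eq_add', or_comm,
    add_comm y 1, add_comm x 1, add_comm 1 y, add_comm 1 x]

theorem toroidalGrid_adj (hm : 2 ≤ m) (hn : 2 ≤ n) {x y : Fin m × Fin n} :
    (toroidalGrid m n).Adj x y ↔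
      x.1 = y.1 ∧ (y.2 = x.2 + 1 ∨ x.2 = y.2 + 1) ∨
        x.2 = y.2 ∧ (y.1 = x.1 + 1 ∨ x.1 = y.1 + 1) := by
  rw [toroidalGrid, SimpleGraph.boxProd_adj, cycleGraph_adj_iff hm, cycleGraph_adj_iff hn]
  tauto

theorem isRegularOfDegree_toroidalGrid [DecidableRel (toroidalGrid m n).Adj] (hm : 3 ≤ m)
    (hn : 3 ≤ n) : (toroidalGrid m n).IsRegularOfDegree 4 := by
  obtain ⟨k, rfl⟩ : ∃ k, m = k + 3 := ⟨m - 3, by omega⟩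
  obtain ⟨l, rfl⟩ : ∃ l, n = l + 3 := ⟨n - 3, by omega⟩
  intro v
  have h : (toroidalGrid (k + 3) (l + 3)).degree v =
      (SimpleGraph.cycleGraph (k + 3)).degree v.1 + (SimpleGraph.cycleGraph (l + 3)).degree v.2 := by
    rw [← SimpleGraph.degree_boxProd v, ← SimpleGraph.card_neighborSet_eq_degree,
      ← SimpleGraph.card_neighborSet_eq_degree]
    exact Fintype.card_congr (Equiv.refl _)
  rw [h, SimpleGraph.cycleGraph_degree_three_le, SimpleGraph.cycleGraph_degree_three_le]

theorem hEdge_mem_edgeSet (hm : 2 ≤ m) (hn : 2 ≤ n) (v : Fin m × Fin n) :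
    hEdge v ∈ (toroidalGrid m n).edgeSet := by
  rw [hEdge, SimpleGraph.mem_edgeSet, toroidalGrid_adj hm hn]
  simp

theorem vEdge_mem_edgeSet (hm : 2 ≤ m) (hn : 2 ≤ n) (v : Fin m × Fin n) :
    vEdge v ∈ (toroidalGrid m n).edgeSet := by
  rw [vEdge, SimpleGraph.mem_edgeSet, toroidalGrid_adj hm hn]
  simp

theorem mem_edgeSet_toroidalGrid (hm : 2 ≤ m) (hn : 2 ≤ n) {e : Sym2 (Fin m × Fin n)}
    (he : e ∈ (toroidalGrid m n).edgeSet) : ∃ v, e = hEdge v ∨ e = vEdge v := by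
  induction e with
  | _ x y =>
    rw [SimpleGraph.mem_edgeSet, toroidalGrid_adj hm hn] at he
    rcases x with ⟨x1, x2⟩
    rcases y with ⟨y1, y2⟩
    rcases he with ⟨h, h' | h'⟩ | ⟨h, h' | h'⟩ <;> simp only at h h' <;> subst h h'
    · exact ⟨_, Or.inl rfl⟩
    · exact ⟨_, Or.inl Sym2.eq_swap⟩
    · exact ⟨_, Or.inr rfl⟩
    · exact ⟨_, Or.inr Sym2.eq_swap⟩

theorem mem_hEdge {m n : ℕ} [NeZero n] {v w : Fin m × Fin n} :
    w ∈ hEdge v ↔ v = w ∨ v = (w.1, w.2 - 1) := by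
  rcases v with ⟨v1, v2⟩
  rcases w with ⟨w1, w2⟩
  simp only [hEdge, Sym2.mem_iff, Prod.mk.injEq, eq_sub_iff_add_eq]
  simp only [eq_comm]

theorem mem_vEdge {m n : ℕ} [NeZero m] {v w : Fin m × Fin n} :
    w ∈ vEdge v ↔ v = w ∨ v = (w.1 - 1, w.2) := by
  rcases v with ⟨v1, v2⟩
  rcases w with ⟨w1, w2⟩
  simp only [vEdge, Sym2.mem_iff, Prod.mk.injEq, eq_sub_iff_add_eq]
  simp only [eq_comm]

theorem hEdge_injective {m n : ℕ} [NeZero n] (hn : 3 ≤ n) :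
    Function.Injective (hEdge : Fin m × Fin n → Sym2 (Fin m × Fin n)) := by
  rintro ⟨u1, u2⟩ ⟨v1, v2⟩ h
  simp only [hEdge, Sym2.eq_iff, Prod.mk.injEq] at h
  rcases h with h | ⟨⟨-, h1⟩, -, h2⟩
  · rw [h.1.1, h.1.2]
  · exact absurd (h1 ▸ h2) (Fin.add_one_add_one_ne_self hn v2)

theorem vEdge_injective {m n : ℕ} [NeZero m] (hm : 3 ≤ m) :
    Function.Injective (vEdge : Fin m × Fin n → Sym2 (Fin m × Fin n)) := by
  rintro ⟨u1, u2⟩ ⟨v1, v2⟩ h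
  simp only [vEdge, Sym2.eq_iff, Prod.mk.injEq] at h
  rcases h with h | ⟨⟨h1, -⟩, h2, -⟩
  · rw [h.1.1, h.1.2]
  · exact absurd (h1 ▸ h2) (Fin.add_one_add_one_ne_self hm v1)

theorem hEdge_ne_vEdge (hn : 2 ≤ n) (u v : Fin m × Fin n) : hEdge u ≠ vEdge v := by
  rcases u with ⟨u1, u2⟩
  rcases v with ⟨v1, v2⟩
  intro h
  simp only [hEdge, vEdge, Sym2.eq_iff, Prod.mk.injEq] at h
  rcases h with ⟨h1, h2⟩ | ⟨h1, h2⟩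
  · exact Fin.add_one_ne_self hn u2 (h2.2.trans h1.2.symm)
  · exact Fin.add_one_ne_self hn u2 (h2.2.trans h1.2.symm)

/-! ### Proper edge colourings of the toroidal grid -/

/-- An edge colouring of the toroidal grid, where `cH v` and `cV v` are the colours of `hEdge v`
and `vEdge v`, is proper if the four edges at each vertex have distinct colours. -/
def IsProperColouring (cH cV : Fin m × Fin n → ℕ) : Prop :=
  ∀ i j, cH (i, j) ≠ cH (i, j - 1) ∧ cV (i, j) ≠ cV (i - 1, j) ∧ cH (i, j) ≠ cV (i, j) ∧
    cH (i, j) ≠ cV (i - 1, j) ∧ cH (i, j - 1) ≠ cV (i, j) ∧ cH (i, j - 1) ≠ cV (i - 1, j)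

/-- The set of edges of colour `k`. -/
def colourClass (cH cV : Fin m × Fin n → ℕ) (k : ℕ) : Finset (Sym2 (Fin m × Fin n)) :=
  (univ.filter (cH · = k)).image hEdge ∪ (univ.filter (cV · = k)).image vEdge

theorem hEdge_mem_colourClass (hn : 3 ≤ n) {cH cV : Fin m × Fin n → ℕ} {k : ℕ}
    {v : Fin m × Fin n} : hEdge v ∈ colourClass cH cV k ↔ cH v = k := by
  simp only [colourClass, mem_union, mem_image, mem_filter, mem_univ, true_and]
  constructor
  · rintro (⟨w, hw, h⟩ | ⟨w, hw, h⟩)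
    · rw [← hEdge_injective hn h, hw]
    · exact absurd h.symm (hEdge_ne_vEdge (by omega) _ _)
  · exact fun h => Or.inl ⟨v, h, rfl⟩

theorem vEdge_mem_colourClass (hm : 3 ≤ m) (hn : 2 ≤ n) {cH cV : Fin m × Fin n → ℕ} {k : ℕ}
    {v : Fin m × Fin n} : vEdge v ∈ colourClass cH cV k ↔ cV v = k := by
  simp only [colourClass, mem_union, mem_image, mem_filter, mem_univ, true_and]
  constructor
  · rintro (⟨w, hw, h⟩ | ⟨w, hw, h⟩)
    · exact absurd h (hEdge_ne_vEdge hn _ _)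
    · rw [← vEdge_injective hm h, hw]
  · exact fun h => Or.inr ⟨v, h, rfl⟩

theorem IsProperColouring.isEdgeMatching (hm : 2 ≤ m) (hn : 2 ≤ n) {cH cV : Fin m × Fin n → ℕ}
    (hc : IsProperColouring cH cV) (k : ℕ) :
    IsEdgeMatching (toroidalGrid m n) (colourClass cH cV k) := by
  have key : ∀ e ∈ colourClass cH cV k, ∀ w ∈ e,
      cH w = k ∧ e = hEdge w ∨ cH (w.1, w.2 - 1) = k ∧ e = hEdge (w.1, w.2 - 1) ∨
      cV w = k ∧ e = vEdge w ∨ cV (w.1 - 1, w.2) = k ∧ e = vEdge (w.1 - 1, w.2) := by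
    intro e he w hw
    simp only [colourClass, mem_union, mem_image, mem_filter, mem_univ, true_and] at he
    rcases he with ⟨v, hv, rfl⟩ | ⟨v, hv, rfl⟩
    · rcases mem_hEdge.1 hw with rfl | rfl
      · exact Or.inl ⟨hv, rfl⟩
      · exact Or.inr (Or.inl ⟨hv, rfl⟩)
    · rcases mem_vEdge.1 hw with rfl | rfl
      · exact Or.inr (Or.inr (Or.inl ⟨hv, rfl⟩))
      · exact Or.inr (Or.inr (Or.inr ⟨hv, rfl⟩))
  refine ⟨fun e he => ?_, fun e he f hf hef w hwe hwf => hef ?_⟩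
  · simp only [colourClass, mem_union, mem_image] at he
    rcases he with ⟨v, -, rfl⟩ | ⟨v, -, rfl⟩
    · exact hEdge_mem_edgeSet hm hn v
    · exact vEdge_mem_edgeSet hm hn v
  · obtain ⟨h1, h2, h3, h4, h5, h6⟩ := hc w.1 w.2
    rcases key e he w hwe with ⟨he1, he2⟩ | ⟨he1, he2⟩ | ⟨he1, he2⟩ | ⟨he1, he2⟩ <;>
      rcases key f hf w hwf with ⟨hf1, hf2⟩ | ⟨hf1, hf2⟩ | ⟨hf1, hf2⟩ | ⟨hf1, hf2⟩ <;>
      first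
      | exact he2.trans hf2.symm
      | (exfalso; simp only [Prod.mk.eta] at h1 h2 h3 h4 h5 h6; omega)

theorem card_colourClass (hm : 3 ≤ m) (hn : 3 ≤ n) (cH cV : Fin m × Fin n → ℕ) (k : ℕ) :
    (colourClass cH cV k).card =
      (univ.filter (cH · = k)).card + (univ.filter (cV · = k)).card := by
  rw [colourClass, card_union_of_disjoint, card_image_of_injective _ (hEdge_injective hn),
    card_image_of_injective _ (vEdge_injective hm)]
  refine disjoint_left.2 fun e he he' => ?_
  obtain ⟨u, -, rfl⟩ := mem_image.1 he
  obtain ⟨v, -, h⟩ := mem_image.1 he'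
  exact hEdge_ne_vEdge (by omega) _ _ h.symm

/-- If all but `r` edges have a colour below `4`, and no matching has more than `ν` edges, where
`4 * ν` is the number of these edges, then the four colour classes are maximum matchings. -/
theorem IsProperColouring.isMaximumMatching (hm : 3 ≤ m) (hn : 3 ≤ n)
    {cH cV : Fin m × Fin n → ℕ} (hc : IsProperColouring cH cV) {ν r : ℕ}
    (hν : m * n ≤ 2 * ν + 1)
    (hν' : 4 * ν + r ≤ 2 * (m * n))
    (hr : (univ.filter fun v => 4 ≤ cH v).card + (univ.filter fun v => 4 ≤ cV v).card ≤ r)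
    {k : ℕ} (hk : k < 4) :
    IsMaximumMatching (toroidalGrid m n) (colourClass cH cV k) ∧
      (colourClass cH cV k).card = ν := by
  have hcard : Fintype.card (Fin m × Fin n) = m * n := by simp
  refine isMaximumMatching_of_sum_card (fun N hN => ?_)
    (fun k _ => hc.isEdgeMatching (by omega) (by omega) k) ?_ hk
  · have := hN.two_mul_card_le
    omega
  · have hsum : ∀ c : Fin m × Fin n → ℕ,
        ∑ k ∈ range 4, (univ.filter (c · = k)).card + (univ.filter fun v => 4 ≤ c v).card
          = m * n := by
      intro c
      have h1 := card_eq_sum_card_fiberwise (f := c) (s := univ.filter fun v => ¬ 4 ≤ c v)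
        (t := range 4) (fun v hv => by
          simp only [coe_filter, mem_univ, true_and, Set.mem_ofPred_eq] at hv
          simpa using hv)
      have h2 := card_filter_add_card_filter_not (s := (univ : Finset (Fin m × Fin n)))
        (fun v => 4 ≤ c v)
      rw [card_univ, hcard] at h2
      rw [← h2, h1, add_comm]
      congr 1
      refine sum_congr rfl fun k hk => ?_
      rw [filter_filter]
      congr 1
      ext v
      simp only [mem_filter, mem_univ, true_and]
      rw [mem_range] at hk
      omega
    have hH := hsum cH
    have hV := hsum cV
    simp only [card_colourClass hm hn, sum_add_distrib]
    omega

end Torus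

/-! ### Lower bounds from edge colourings -/

section LowerBound

variable {m n : ℕ} [NeZero m] [NeZero n]

/-- Properness of a translated colouring is checked on representatives in `ℕ`; here `i'` and `j'`
are the cyclic predecessors of `i` and `j`. -/
theorem isProperColouring_translate (hm : 2 ≤ m) (hn : 2 ≤ n) {fH fV : ℕ → ℕ → ℕ}
    (h : ∀ i i' j j', i < m → j < n → (i' + 1 = i ∨ i = 0 ∧ i' + 1 = m) →
      (j' + 1 = j ∨ j = 0 ∧ j' + 1 = n) →
      fH i j ≠ fH i j' ∧ fV i j ≠ fV i' j ∧ fH i j ≠ fV i j ∧ fH i j ≠ fV i' j ∧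
        fH i j' ≠ fV i j ∧ fH i j' ≠ fV i' j) (a : Fin m) (b : Fin n) :
    IsProperColouring (fun v => fH (v.1 - a).val (v.2 - b).val)
      (fun v => fV (v.1 - a).val (v.2 - b).val) := by
  intro i j
  have hi := Fin.val_sub_one_cases hm (i - a)
  have hj := Fin.val_sub_one_cases hn (j - b)
  rw [sub_right_comm] at hi hj
  exact h _ _ _ _ (i - a).2 (j - b).2 hi hj

theorem colourClass_disjoint (hm : 3 ≤ m) (hn : 3 ≤ n) {cH cV : Fin m × Fin n → ℕ} {k l : ℕ}
    (hkl : k ≠ l) : Disjoint (colourClass cH cV k) (colourClass cH cV l) := by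
  refine disjoint_left.2 fun e he he' => hkl ?_
  have he₁ := he
  rw [colourClass, mem_union, mem_image, mem_image] at he₁
  rcases he₁ with ⟨v, -, rfl⟩ | ⟨v, -, rfl⟩
  · exact ((hEdge_mem_colourClass hn).1 he).symm.trans ((hEdge_mem_colourClass hn).1 he')
  · exact ((vEdge_mem_colourClass hm (by omega)).1 he).symm.trans
      ((vEdge_mem_colourClass hm (by omega)).1 he')

/-- A transversal set has at least `d` edges in every colour class that is a maximum matching, and
the colour classes are disjoint. -/
theorem IsTransversalSet.card_mul_le (hm : 3 ≤ m) (hn : 3 ≤ n) {cH cV : Fin m × Fin n → ℕ} {d : ℕ}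
    {T X : Finset (Sym2 (Fin m × Fin n))} (hT : IsTransversalSet (toroidalGrid m n) d T)
    {s : Finset ℕ} (hs : ∀ k ∈ s, IsMaximumMatching (toroidalGrid m n) (colourClass cH cV k))
    (hX : ∀ k ∈ s, T ∩ colourClass cH cV k ⊆ X) : s.card * d ≤ X.card := by
  have h1 : (s.biUnion fun k => T ∩ colourClass cH cV k).card ≤ X.card :=
    card_le_card (biUnion_subset.2 hX)
  rw [card_biUnion fun k _ l _ hkl =>
    (colourClass_disjoint hm hn hkl).mono inter_subset_right inter_subset_right] at h1
  refine le_trans ?_ h1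
  rw [← smul_eq_mul]
  exact card_nsmul_le_sum _ _ _ fun k hk => hT.2 _ (hs k hk)

/-- If `m` is even, the toroidal grid has a proper edge colouring with four colours. For even `n`
the rows and the columns are alternately coloured. For odd `n`, in the rows `i` and `i + 1` with
`i` even, the edges between the columns `1` and `2` are exchanged with the edges of these columns
between the two rows. This turns each such pair of rows into an even cycle, and the pair of columns
into disjoint `4`-cycles. -/
theorem exists_colouring_of_even (hm : 3 ≤ m) (hn : 3 ≤ n) (hme : Even m) :
    ∃ cH cV : Fin m × Fin n → ℕ, ∀ k < 4,
      IsMaximumMatching (toroidalGrid m n) (colourClass cH cV k) ∧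
        2 * (colourClass cH cV k).card = m * n := by
  obtain ⟨μ, hμ⟩ := hme
  obtain ⟨cH, cV, hc, hH, hV⟩ : ∃ cH cV : Fin m × Fin n → ℕ, IsProperColouring cH cV ∧
      (∀ v, cH v < 4) ∧ ∀ v, cV v < 4 := by
    rcases Nat.even_or_odd n with ⟨ν, hν⟩ | ⟨ν, hν⟩
    · refine ⟨_, _, isProperColouring_translate (m := m) (n := n) (by omega) (by omega)
        (fH := fun _ j => j % 2) (fV := fun i _ => 2 + i % 2)
        (fun i i' j j' _ _ _ _ => by omega) 0 0, fun v => ?_, fun v => ?_⟩ <;> omega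
    · refine ⟨_, _, isProperColouring_translate (m := m) (n := n) (by omega) (by omega)
        (fH := fun _ j => if j = 1 then 2 else if j = 0 then 1 else j % 2)
        (fV := fun i j => if i % 2 = 1 then 3 else if j = 1 then 0 else if j = 2 then 1 else 2)
        (fun i i' j j' _ _ _ _ => by
          refine ⟨?_, ?_, ?_, ?_, ?_, ?_⟩ <;> split_ifs <;> omega) 0 0,
        fun v => ?_, fun v => ?_⟩ <;> split_ifs <;> omega
  have hmn : m * n = 2 * (μ * n) := by rw [hμ]; ring
  refine ⟨cH, cV, fun k hk => ?_⟩
  have := hc.isMaximumMatching (ν := μ * n) (r := 0) hm hn (by omega) (by omega) ?_ hk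
  · exact ⟨this.1, by omega⟩
  · rw [Nat.le_zero, Nat.add_eq_zero_iff, card_eq_zero, card_eq_zero,
      filter_eq_empty_iff, filter_eq_empty_iff]
    exact ⟨fun v _ => not_le.2 (hH v), fun v _ => not_le.2 (hV v)⟩

theorem IsTransversalSet.four_mul_le_of_even (hm : 3 ≤ m) (hn : 3 ≤ n) (hme : Even m)
    {d : ℕ} {T : Finset (Sym2 (Fin m × Fin n))}
    (hT : IsTransversalSet (toroidalGrid m n) d T) : 4 * d ≤ T.card := by
  obtain ⟨cH, cV, hc⟩ := exists_colouring_of_even (n := n) hm hn hme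
  exact hT.card_mul_le (s := range 4) hm hn (fun k hk => (hc k (mem_range.1 hk)).1)
    fun k _ => inter_subset_left

/-- Colours of the edges `hEdge (i, j)` of an odd by odd grid, where all edges except
`hEdge (0, q)` and `vEdge (p, 0)` get a colour below `4`. Start from the rows with colours `0`, `1`
and the columns with colours `2`, `3`. In every square with corner `(i, j)`, `i` and `j` odd, the two
horizontal edges are exchanged with the two vertical ones. The rows other than row `0` are thereby
joined, in pairs, into even cycles, as are the columns other than column `0`. The odd cycles
that remain, row `0` and column `0`, become alternately coloured paths when their edge at `q` or
`p` is removed. -/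
def oddColourH (q i j : ℕ) : ℕ :=
  if i = 0 then (if j = q then 4 else if q < j then (j + q + 1) % 2 else (j + q) % 2)
  else if j % 2 = 1 then (if i = 1 then 2 else 3) else if j = 0 then 1 else 0

/-- Colours of the edges `vEdge (i, j)` of an odd by odd grid: `oddColourH` with the roles of rows and
columns exchanged. -/
def oddColourV (p i j : ℕ) : ℕ :=
  if j = 0 then (if i = p then 5 else if p < i then 2 + (i + p + 1) % 2 else 2 + (i + p) % 2)
  else if i % 2 = 1 then (if j = 1 then 0 else 1) else if i = 0 then 3 else 2

theorem isProperColouring_odd (hm : 3 ≤ m) (hn : 3 ≤ n) (hmo : Odd m) (hno : Odd n) {p q : ℕ}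
    (hp : p < m) (hq : q < n) (a : Fin m) (b : Fin n) :
    IsProperColouring (fun v => oddColourH q (v.1 - a).val (v.2 - b).val)
      (fun v => oddColourV p (v.1 - a).val (v.2 - b).val) := by
  obtain ⟨μ, hμ⟩ := hmo
  obtain ⟨ν, hν⟩ := hno
  refine isProperColouring_translate (by omega) (by omega) (fun i i' j j' _ _ hi hj => ?_) a b
  unfold oddColourH oddColourV
  refine ⟨?_, ?_, ?_, ?_, ?_, ?_⟩ <;> split_ifs <;> omega

theorem isMaximumMatching_odd (hm : 3 ≤ m) (hn : 3 ≤ n) (hmo : Odd m) (hno : Odd n) {p q : ℕ}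
    (hp : p < m) (hq : q < n) (a : Fin m) (b : Fin n) {k : ℕ} (hk : k < 4) :
    IsMaximumMatching (toroidalGrid m n)
      (colourClass (fun v => oddColourH q (v.1 - a).val (v.2 - b).val)
        (fun v => oddColourV p (v.1 - a).val (v.2 - b).val) k) ∧
    2 * (colourClass (fun v => oddColourH q (v.1 - a).val (v.2 - b).val)
        (fun v => oddColourV p (v.1 - a).val (v.2 - b).val) k).card + 1 = m * n := by
  obtain ⟨ν, hν⟩ := hmo.mul hno
  have := (isProperColouring_odd hm hn hmo hno hp hq a b).isMaximumMatching (ν := ν) (r := 2) hm hn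
    (by omega) (by omega) ?_ hk
  · exact ⟨this.1, by omega⟩
  · refine add_le_add (b := 1) (d := 1) (card_le_one.2 ?_) (card_le_one.2 ?_)
    · have h : ∀ v : Fin m × Fin n, 4 ≤ oddColourH q (v.1 - a).val (v.2 - b).val →
          (v.1 - a).val = 0 ∧ (v.2 - b).val = q := by
        intro v hv
        unfold oddColourH at hv
        split_ifs at hv <;> omega
      intro u hu v hv
      have hu := h u (mem_filter.1 hu).2
      have hv := h v (mem_filter.1 hv).2
      exact Prod.ext (sub_left_injective (Fin.ext (hu.1.trans hv.1.symm)))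
        (sub_left_injective (Fin.ext (hu.2.trans hv.2.symm)))
    · have h : ∀ v : Fin m × Fin n, 4 ≤ oddColourV p (v.1 - a).val (v.2 - b).val →
          (v.1 - a).val = p ∧ (v.2 - b).val = 0 := by
        intro v hv
        unfold oddColourV at hv
        split_ifs at hv <;> omega
      intro u hu v hv
      have hu := h u (mem_filter.1 hu).2
      have hv := h v (mem_filter.1 hv).2
      exact Prod.ext (sub_left_injective (Fin.ext (hu.1.trans hv.1.symm)))
        (sub_left_injective (Fin.ext (hu.2.trans hv.2.symm)))

theorem Fin.not_odd_sub_add_one (hn : 2 ≤ n) {x a : Fin n} (h : Odd (x - a).val) :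
    ¬ Odd (x - (a + 1)).val := by
  have := Fin.val_sub_one_cases hn (x - a)
  rw [sub_sub] at this
  rw [Nat.odd_iff] at h ⊢
  omega

theorem Fin.not_odd_sub_self_add_one (hn : 2 ≤ n) (hno : Odd n) (a : Fin n) :
    ¬ Odd (a - (a + 1)).val := by
  have := Fin.val_sub_one_cases hn (a - a)
  rw [sub_sub, sub_self, Fin.val_zero] at this
  rw [Nat.odd_iff] at hno ⊢
  omega

open Classical in
/-- If `T` has only column edges, those of colours `0` and `1` already number `2 * d`, and they avoid
the column `b` and the edges between the rows `a` and `a + 1`. -/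
theorem IsTransversalSet.two_mul_le_card_filter_vEdge (hm : 3 ≤ m) (hn : 3 ≤ n) (hmo : Odd m)
    (hno : Odd n) {d : ℕ} {T : Finset (Sym2 (Fin m × Fin n))}
    (hT : IsTransversalSet (toroidalGrid m n) d T) (hTV : ∀ v, hEdge v ∉ T)
    (a : Fin m) (b : Fin n) :
    2 * d ≤ (T.filter fun e => ∃ v, e = vEdge v ∧ Odd (v.1 - a).val ∧ v.2 ≠ b).card := by
  refine hT.card_mul_le (s := {0, 1}) hm hn (fun k hk =>
    (isMaximumMatching_odd hm hn hmo hno (p := 0) (q := 0) (by omega) (by omega) a b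
      (k := k) ?_).1) fun k hk e he => ?_
  · simp only [mem_insert, mem_singleton] at hk
    omega
  · obtain ⟨he, hec⟩ := mem_inter.1 he
    obtain ⟨v, rfl | rfl⟩ := mem_edgeSet_toroidalGrid (by omega) (by omega) (hT.1 e he)
    · exact absurd he (hTV v)
    · rw [vEdge_mem_colourClass hm (by omega)] at hec
      refine mem_filter.2 ⟨he, v, rfl, ?_, ?_⟩
      · rw [Nat.odd_iff]
        simp only [mem_insert, mem_singleton] at hk
        unfold oddColourV at hec
        split_ifs at hec <;> omega
      · rintro rfl
        simp only [mem_insert, mem_singleton] at hk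
        unfold oddColourV at hec
        rw [sub_self, Fin.val_zero, if_pos rfl] at hec
        split_ifs at hec <;> omega

open Classical in
/-- If `T` has only row edges, those of colours `2` and `3` already number `2 * d`, and they avoid
the row `a` and the edges between the columns `b` and `b + 1`. -/
theorem IsTransversalSet.two_mul_le_card_filter_hEdge (hm : 3 ≤ m) (hn : 3 ≤ n) (hmo : Odd m)
    (hno : Odd n) {d : ℕ} {T : Finset (Sym2 (Fin m × Fin n))}
    (hT : IsTransversalSet (toroidalGrid m n) d T) (hTH : ∀ v, vEdge v ∉ T)
    (a : Fin m) (b : Fin n) :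
    2 * d ≤ (T.filter fun e => ∃ v, e = hEdge v ∧ Odd (v.2 - b).val ∧ v.1 ≠ a).card := by
  refine hT.card_mul_le (s := {2, 3}) hm hn (fun k hk =>
    (isMaximumMatching_odd hm hn hmo hno (p := 0) (q := 0) (by omega) (by omega) a b
      (k := k) ?_).1) fun k hk e he => ?_
  · simp only [mem_insert, mem_singleton] at hk
    omega
  · obtain ⟨he, hec⟩ := mem_inter.1 he
    obtain ⟨v, rfl | rfl⟩ := mem_edgeSet_toroidalGrid (by omega) (by omega) (hT.1 e he)
    · rw [hEdge_mem_colourClass hn] at hec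
      refine mem_filter.2 ⟨he, v, rfl, ?_, ?_⟩
      · rw [Nat.odd_iff]
        simp only [mem_insert, mem_singleton] at hk
        unfold oddColourH at hec
        split_ifs at hec <;> omega
      · rintro rfl
        simp only [mem_insert, mem_singleton] at hk
        unfold oddColourH at hec
        rw [sub_self, Fin.val_zero, if_pos rfl] at hec
        split_ifs at hec <;> omega
    · exact absurd he (hTH v)

theorem add_two_le_card_of_disjoint_subset {α : Type*} [DecidableEq α] {T X Y : Finset α}
    {k : ℕ} {e f : α} (hX : X ⊆ T) (hY : Y ⊆ T) (hXY : Disjoint X Y) (hXc : k ≤ X.card)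
    (hYc : k ≤ Y.card) (he : e ∈ T) (hf : f ∈ T) (hef : e ≠ f) (heX : e ∉ X) (heY : e ∉ Y)
    (hfX : f ∉ X) (hfY : f ∉ Y) : 2 * k + 2 ≤ T.card := by
  have h1 : X ∪ Y ⊆ (T.erase e).erase f := by
    intro x hx
    rw [mem_erase, mem_erase]
    rcases mem_union.1 hx with hx | hx
    · exact ⟨fun h => hfX (h ▸ hx), fun h => heX (h ▸ hx), hX hx⟩
    · exact ⟨fun h => hfY (h ▸ hx), fun h => heY (h ▸ hx), hY hx⟩
  have h2 := card_le_card h1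
  rw [card_union_of_disjoint hXY] at h2
  have h3 := card_erase_add_one he
  have h4 := card_erase_add_one (mem_erase.2 ⟨hef.symm, hf⟩)
  omega

theorem IsTransversalSet.add_two_le_of_odd_of_odd (hm : 3 ≤ m) (hn : 3 ≤ n) (hmo : Odd m)
    (hno : Odd n) {d : ℕ} (hd : 1 ≤ d) {T : Finset (Sym2 (Fin m × Fin n))}
    (hT : IsTransversalSet (toroidalGrid m n) d T) : 4 * d + 2 ≤ T.card := by
  classical
  have hdec : ∀ e ∈ T, ∃ v, e = hEdge v ∨ e = vEdge v := fun e he =>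
    mem_edgeSet_toroidalGrid (by omega) (by omega) (hT.1 e he)
  by_cases hH : ∃ u, hEdge u ∈ T
  · by_cases hV : ∃ v, vEdge v ∈ T
    · -- The uncoloured edges are placed in `T`, so four matchings share the other edges of `T`.
      obtain ⟨u, hu⟩ := hH
      obtain ⟨v, hv⟩ := hV
      have h1 := hT.card_mul_le (s := range 4) (X := (T.erase (hEdge u)).erase (vEdge v)) hm hn
        (fun k hk => (isMaximumMatching_odd hm hn hmo hno (v.1 - u.1).2 (u.2 - v.2).2 u.1 v.2
          (mem_range.1 hk)).1) fun k hk e he => by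
            have hk := mem_range.1 hk
            obtain ⟨he, hec⟩ := mem_inter.1 he
            rw [mem_erase, mem_erase]
            refine ⟨?_, ?_, he⟩
            · rintro rfl
              rw [vEdge_mem_colourClass hm (by omega)] at hec
              simp [oddColourV] at hec
              omega
            · rintro rfl
              rw [hEdge_mem_colourClass hn] at hec
              simp [oddColourH] at hec
              omega
      have h3 := card_erase_add_one hu
      have h4 := card_erase_add_one
        (mem_erase.2 ⟨(hEdge_ne_vEdge (by omega) u v).symm, hv⟩)
      rw [card_range] at h1
      omega
    · -- Two translates of the classes of colours `2`, `3` are disjoint on the rows, and the omitted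
      -- edges can be chosen to include two edges of `T`.
      push Not at hV
      have hcard := fun a b => hT.two_mul_le_card_filter_hEdge hm hn hmo hno hV a b
      obtain ⟨u, hu⟩ := hH
      obtain ⟨e, he⟩ : (T.filter fun e => ∃ v, e = hEdge v ∧ Odd (v.2 - 0).val ∧ v.1 ≠ u.1).Nonempty
        := card_pos.1 (by have := hcard u.1 0; omega)
      obtain ⟨he, v, rfl, -, hvu⟩ := mem_filter.1 he
      have := add_two_le_card_of_disjoint_subset (filter_subset _ _) (filter_subset _ _) ?_
        (hcard u.1 v.2) (hcard u.1 (v.2 + 1)) hu he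
        (fun h => hvu (by rw [hEdge_injective hn h])) ?_ ?_ ?_ ?_
      · omega
      · refine disjoint_left.2 fun e he he' => ?_
        obtain ⟨-, x, rfl, hx, -⟩ := mem_filter.1 he
        obtain ⟨-, y, hy, hy', -⟩ := mem_filter.1 he'
        rw [← hEdge_injective hn hy] at hy'
        exact Fin.not_odd_sub_add_one (by omega) hx hy'
      all_goals
        intro h
        obtain ⟨-, x, hx, hx', hx''⟩ := mem_filter.1 h
        rw [← hEdge_injective hn hx] at hx' hx''
      · exact hx'' rfl
      · exact hx'' rfl
      · rw [sub_self, Fin.val_zero] at hx'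
        exact absurd hx' (by decide)
      · exact Fin.not_odd_sub_self_add_one (by omega) hno _ hx'
  · push Not at hH
    have hcard := fun a b => hT.two_mul_le_card_filter_vEdge hm hn hmo hno hH a b
    obtain ⟨e, he⟩ : (T.filter fun e => ∃ v, e = vEdge v ∧ Odd (v.1 - 0).val ∧ v.2 ≠ 0).Nonempty
      := card_pos.1 (by have := hcard 0 0; omega)
    obtain ⟨hu, u, rfl, -, -⟩ := mem_filter.1 he
    obtain ⟨e, he⟩ : (T.filter fun e => ∃ v, e = vEdge v ∧ Odd (v.1 - 0).val ∧ v.2 ≠ u.2).Nonempty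
      := card_pos.1 (by have := hcard 0 u.2; omega)
    obtain ⟨he, v, rfl, -, hvu⟩ := mem_filter.1 he
    have := add_two_le_card_of_disjoint_subset (filter_subset _ _) (filter_subset _ _) ?_
      (hcard v.1 u.2) (hcard (v.1 + 1) u.2) hu he
      (fun h => hvu (by rw [vEdge_injective hm h])) ?_ ?_ ?_ ?_
    · omega
    · refine disjoint_left.2 fun e he he' => ?_
      obtain ⟨-, x, rfl, hx, -⟩ := mem_filter.1 he
      obtain ⟨-, y, hy, hy', -⟩ := mem_filter.1 he'
      rw [← vEdge_injective hm hy] at hy'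
      exact Fin.not_odd_sub_add_one (by omega) hx hy'
    all_goals
      intro h
      obtain ⟨-, x, hx, hx', hx''⟩ := mem_filter.1 h
      rw [← vEdge_injective hm hx] at hx' hx''
    · exact hx'' rfl
    · exact hx'' rfl
    · rw [sub_self, Fin.val_zero] at hx'
      exact absurd hx' (by decide)
    · exact Fin.not_odd_sub_self_add_one (by omega) hmo _ hx'

end LowerBound

/-! ### Near-perfect matchings from Tutte's theorem -/

section Tutte

universe u

variable {V : Type u} {H : SimpleGraph V}

/-- The graph obtained from `H` by adding the new vertex `none`, adjacent to all other vertices. -/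
def addUniversalVertex (H : SimpleGraph V) : SimpleGraph (Option V) where
  Adj x y := x ≠ y ∧ ∀ u v, x = some u → y = some v → H.Adj u v
  symm := ⟨fun _ _ h => ⟨h.1.symm, fun u v hu hv => (h.2 v u hv hu).symm⟩⟩
  loopless := ⟨fun _ h => h.1 rfl⟩

theorem addUniversalVertex_adj_some {u v : V} :
    (addUniversalVertex H).Adj (some u) (some v) ↔ H.Adj u v := by
  refine ⟨fun h => h.2 u v rfl rfl, fun h => ⟨fun e => h.ne (Option.some_injective _ e), ?_⟩⟩
  rintro _ _ ⟨⟩ ⟨⟩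
  exact h

theorem addUniversalVertex_adj_none {v : V} : (addUniversalVertex H).Adj none (some v) :=
  ⟨by simp, by simp⟩

theorem exists_isEdgeMatching_of_isPerfectMatching [Fintype V] [DecidableEq V]
    {P : (addUniversalVertex H).Subgraph} (hP : P.IsPerfectMatching) :
    ∃ M, IsEdgeMatching H M ∧ Fintype.card V ≤ 2 * M.card + 1 := by
  classical
  rw [SimpleGraph.Subgraph.isPerfectMatching_iff] at hP
  have hM : IsEdgeMatching H (univ.filter fun e : Sym2 V => e.map some ∈ P.edgeSet) := by
    refine ⟨fun e he => ?_, fun e he f hf hef v hve hvf => hef ?_⟩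
    · induction e with
      | _ x y =>
        simp only [mem_filter, mem_univ, true_and, Sym2.map_mk,
          SimpleGraph.Subgraph.mem_edgeSet] at he
        exact addUniversalVertex_adj_some.1 he.adj_sub
    · obtain ⟨x, rfl⟩ := Sym2.mem_iff_exists.1 hve
      obtain ⟨y, rfl⟩ := Sym2.mem_iff_exists.1 hvf
      simp only [mem_filter, mem_univ, true_and, Sym2.map_mk,
        SimpleGraph.Subgraph.mem_edgeSet] at he hf
      rw [Option.some_injective _ ((hP (some v)).unique he hf)]
  refine ⟨_, hM, ?_⟩
  rw [hM.two_mul_card_eq]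
  obtain ⟨x, hx, -⟩ := hP none
  obtain ⟨v₀, rfl⟩ : ∃ v, x = some v := by
    cases x with
    | none => exact absurd hx.adj_sub ((addUniversalVertex H).irrefl)
    | some v => exact ⟨v, rfl⟩
  have hsub : univ.erase v₀ ⊆
      (univ.filter fun e : Sym2 V => e.map some ∈ P.edgeSet).biUnion Sym2.toFinset := by
    intro v hv
    obtain ⟨y, hy, -⟩ := hP (some v)
    cases y with
    | none =>
      exact absurd (Option.some_injective _ ((hP none).unique hy.symm hx)) (ne_of_mem_erase hv)
    | some w =>
      refine mem_biUnion.2 ⟨s(v, w), mem_filter.2 ⟨mem_univ _, ?_⟩, by simp⟩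
      rwa [Sym2.map_mk, SimpleGraph.Subgraph.mem_edgeSet]
  have := card_le_card hsub
  rw [card_erase_of_mem (mem_univ _), card_univ] at this
  omega

/-- Berge's formula for graphs of odd order: either some matching misses only one vertex, or the
deletion of some set `S` leaves at least `|S| + 3` components. The components are recorded by a map
that takes the value `none` on `S`. -/
theorem exists_near_perfect_matching_or_barrier [Fintype V] [DecidableEq V]
    (hodd : Odd (Fintype.card V)) :
    (∃ M, IsEdgeMatching H M ∧ Fintype.card V ≤ 2 * M.card + 1) ∨
    ∃ (S : Finset V) (C : Type u) (_ : Fintype C) (f : V → Option C),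
      (∀ v, f v = none ↔ v ∈ S) ∧ (∀ c, ∃ v, f v = some c) ∧
      (∀ u v, H.Adj u v → u ∉ S → v ∉ S → f u = f v) ∧ S.card + 3 ≤ Fintype.card C := by
  classical
  by_cases hP : ∃ P : (addUniversalVertex H).Subgraph, P.IsPerfectMatching
  · obtain ⟨P, hP⟩ := hP
    exact Or.inl (exists_isEdgeMatching_of_isPerfectMatching hP)
  right
  rw [SimpleGraph.tutte] at hP
  push Not at hP
  obtain ⟨S', hS'⟩ := hP
  rw [SimpleGraph.IsTutteViolator] at hS'
  set D := ((⊤ : (addUniversalVertex H).Subgraph).deleteVerts S') with hD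
  have hmem : ∀ x, x ∈ D.verts ↔ x ∉ S' := by
    intro x
    simp [hD]
  have hpar := SimpleGraph.odd_ncard_oddComponents (G := D.coe)
  have hcardD : Nat.card D.verts + S'.ncard = Fintype.card V + 1 := by
    have h1 : D.verts = S'ᶜ := by
      ext x
      rw [hmem, Set.mem_compl_iff]
    rw [Nat.card_coe_set_eq, h1, add_comm, Set.ncard_add_ncard_compl, Nat.card_eq_fintype_card,
      Fintype.card_option]
  have hC : D.coe.oddComponents.ncard ≤ Nat.card D.coe.ConnectedComponent :=
    Set.ncard_le_card _
  have hcount : S'.ncard + 2 ≤ D.coe.oddComponents.ncard := by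
    by_contra hlt
    have h1 : D.coe.oddComponents.ncard = S'.ncard + 1 := by omega
    rw [h1, Nat.odd_iff, Nat.odd_iff] at hpar
    rw [Nat.odd_iff] at hodd
    omega
  have hadj : ∀ x y : D.verts, (addUniversalVertex H).Adj x y → D.coe.Adj x y := by
    intro x y hxy
    refine SimpleGraph.Subgraph.deleteVerts_adj.2 ?_
    exact ⟨trivial, (hmem _).1 x.2, trivial, (hmem _).1 y.2, hxy⟩
  -- If the universal vertex survives, there is only one component.
  have hnone : none ∈ S' := by
    by_contra hnone
    have hsub : Subsingleton D.coe.ConnectedComponent := by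
      have key : ∀ c : D.coe.ConnectedComponent,
          c = D.coe.connectedComponentMk ⟨none, (hmem _).2 hnone⟩ := by
        intro c
        induction c using SimpleGraph.ConnectedComponent.ind with
        | _ x =>
          obtain ⟨x, hx⟩ := x
          cases x with
          | none => rfl
          | some v =>
            exact SimpleGraph.ConnectedComponent.sound
              (hadj _ _ addUniversalVertex_adj_none.symm).reachable
      exact ⟨fun a b => (key a).trans (key b).symm⟩
    have := Finite.card_le_one_iff_subsingleton (α := D.coe.ConnectedComponent) |>.2 hsub
    omega
  refine ⟨univ.filter fun v => some v ∈ S', D.coe.ConnectedComponent, inferInstance,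
    fun v => if h : some v ∈ D.verts then some (D.coe.connectedComponentMk ⟨some v, h⟩) else none,
    fun v => ?_, fun c => ?_, fun u v huv hu hv => ?_, ?_⟩
  · rw [mem_filter, dite_eq_right_iff, ← not_iff_not]
    simp [hmem]
  · induction c using SimpleGraph.ConnectedComponent.ind with
    | _ x =>
      obtain ⟨x, hx⟩ := x
      cases x with
      | none => exact absurd hnone ((hmem _).1 hx)
      | some v => exact ⟨v, dif_pos hx⟩
  · have hu' : some u ∈ D.verts := (hmem _).2 (by simpa using hu)
    have hv' : some v ∈ D.verts := (hmem _).2 (by simpa using hv)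
    simp only [dif_pos hu', dif_pos hv']
    exact congrArg some (SimpleGraph.ConnectedComponent.sound
      (hadj ⟨_, hu'⟩ ⟨_, hv'⟩ (addUniversalVertex_adj_some.2 huv)).reachable)
  · have h1 : (univ.filter fun v => some v ∈ S').card + 1 = S'.ncard := by
      have h2 : S' = ((insertNone (univ.filter fun v => some v ∈ S') : Finset (Option V)) :
          Set (Option V)) := by
        ext x
        cases x with
        | none => simp [hnone]
        | some v => simp
      have h3 := congrArg Set.ncard h2
      rw [Set.ncard_coe_finset, card_insertNone] at h3
      exact h3.symm
    rw [← Nat.card_eq_fintype_card]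
    omega

end Tutte

/-! ### Edge boundaries in the toroidal grid -/

section Boundary

variable {m n : ℕ} [NeZero m] [NeZero n]

theorem Fin.forall_mem_of_add_one_mem {s : Finset (Fin n)} {x : Fin n} (hx : x ∈ s)
    (h : ∀ y ∈ s, y + 1 ∈ s) (y : Fin n) : y ∈ s := by
  have key : ∀ k : ℕ, x + Fin.ofNat n k ∈ s := by
    intro k
    induction k with
    | zero => simpa using hx
    | succ k ih =>
      have : x + Fin.ofNat n (k + 1) = x + Fin.ofNat n k + 1 := by
        rw [add_assoc]
        congr 1
        apply Fin.ext
        simp [Fin.val_add]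
      rw [this]
      exact h _ ih
  have := key (y - x).val
  rwa [Fin.ofNat_val_eq_self, add_sub_cancel] at this

/-- A proper nonempty subset of a cycle is left, and entered, by some step of the cycle. -/
theorem Fin.exists_boundary {s : Finset (Fin n)} {x y : Fin n} (hx : x ∈ s) (hy : y ∉ s) :
    (∃ j ∈ s, j + 1 ∉ s) ∧ ∃ j ∉ s, j + 1 ∈ s := by
  constructor
  · by_contra! h
    exact hy (Fin.forall_mem_of_add_one_mem hx h y)
  · by_contra! h
    have := Fin.forall_mem_of_add_one_mem (s := sᶜ) (mem_compl.2 hy)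
      (fun j hj => mem_compl.2 (h j (mem_compl.1 hj))) x
    exact mem_compl.1 this hx

open Classical in
/-- The edges leaving the vertex set `K`, oriented outwards. -/
noncomputable def outBoundary {V : Type*} [Fintype V] (G : SimpleGraph V) (K : Finset V) :
    Finset (V × V) :=
  univ.filter fun p => G.Adj p.1 p.2 ∧ p.1 ∈ K ∧ p.2 ∉ K

theorem mem_outBoundary {V : Type*} [Fintype V] {G : SimpleGraph V} {K : Finset V} {p : V × V} :
    p ∈ outBoundary G K ↔ G.Adj p.1 p.2 ∧ p.1 ∈ K ∧ p.2 ∉ K := by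
  simp [outBoundary]

/-- Each row and each column that meets both `K` and its complement contributes two boundary
edges. -/
theorem two_mul_card_rows_add_card_cols_le (hm : 3 ≤ m) (hn : 3 ≤ n)
    (K : Finset (Fin m × Fin n)) :
    2 * ((univ.filter fun i => ∃ y y', (i, y) ∈ K ∧ (i, y') ∉ K).card +
      (univ.filter fun j => ∃ x x', (x, j) ∈ K ∧ (x', j) ∉ K).card) ≤
      (outBoundary (toroidalGrid m n) K).card := by
  classical
  set B := outBoundary (toroidalGrid m n) K with hB
  have hR : 2 * (univ.filter fun i => ∃ y y', (i, y) ∈ K ∧ (i, y') ∉ K).card ≤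
      (B.filter fun p => p.1.1 = p.2.1).card := by
    rw [mul_comm, ← smul_eq_mul]
    refine (card_nsmul_le_sum _
      (fun i => ((B.filter fun p => p.1.1 = p.2.1).filter fun p => p.1.1 = i).card) 2 ?_).trans ?_
    · intro i hi
      obtain ⟨-, y, y', hy, hy'⟩ := mem_filter.1 hi
      obtain ⟨⟨j, hj, hj'⟩, k, hk, hk'⟩ := Fin.exists_boundary
        (s := univ.filter fun y => (i, y) ∈ K) (x := y) (y := y') (by simpa using hy)
        (by simpa using hy')
      simp only [mem_filter, mem_univ, true_and] at hj hj' hk hk'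
      refine one_lt_card.2 ⟨((i, j), (i, j + 1)), ?_, ((i, k + 1), (i, k)), ?_, ?_⟩
      · simp only [mem_filter, hB, mem_outBoundary, toroidalGrid_adj (by omega : 2 ≤ m)
          (by omega : 2 ≤ n)]
        simp [hj, hj']
      · simp only [mem_filter, hB, mem_outBoundary, toroidalGrid_adj (by omega : 2 ≤ m)
          (by omega : 2 ≤ n)]
        simp [hk, hk']
      · intro h
        simp only [Prod.mk.injEq, true_and] at h
        exact Fin.add_one_add_one_ne_self hn k (h.1 ▸ h.2)
    · rw [← card_biUnion]
      · exact card_le_card (biUnion_subset.2 fun i _ => filter_subset _ _)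
      · intro i _ j _ hij
        refine disjoint_left.2 fun p hp hp' => hij ?_
        exact (mem_filter.1 hp).2.symm.trans (mem_filter.1 hp').2
  have hC : 2 * (univ.filter fun j => ∃ x x', (x, j) ∈ K ∧ (x', j) ∉ K).card ≤
      (B.filter fun p => ¬ p.1.1 = p.2.1).card := by
    rw [mul_comm, ← smul_eq_mul]
    refine (card_nsmul_le_sum _
      (fun j => ((B.filter fun p => ¬ p.1.1 = p.2.1).filter fun p => p.1.2 = j).card) 2 ?_).trans ?_
    · intro i hi
      obtain ⟨-, y, y', hy, hy'⟩ := mem_filter.1 hi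
      obtain ⟨⟨j, hj, hj'⟩, k, hk, hk'⟩ := Fin.exists_boundary
        (s := univ.filter fun y => (y, i) ∈ K) (x := y) (y := y') (by simpa using hy)
        (by simpa using hy')
      simp only [mem_filter, mem_univ, true_and] at hj hj' hk hk'
      refine one_lt_card.2 ⟨((j, i), (j + 1, i)), ?_, ((k + 1, i), (k, i)), ?_, ?_⟩
      · simp only [mem_filter, hB, mem_outBoundary, toroidalGrid_adj (by omega : 2 ≤ m)
          (by omega : 2 ≤ n)]
        refine ⟨⟨⟨by simp, hj, hj'⟩, (Fin.add_one_ne_self (by omega) j).symm⟩, trivial⟩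
      · simp only [mem_filter, hB, mem_outBoundary, toroidalGrid_adj (by omega : 2 ≤ m)
          (by omega : 2 ≤ n)]
        refine ⟨⟨⟨by simp, hk', hk⟩, Fin.add_one_ne_self (by omega) k⟩, trivial⟩
      · intro h
        simp only [Prod.mk.injEq, and_true] at h
        exact Fin.add_one_add_one_ne_self hm k (h.1 ▸ h.2)
    · rw [← card_biUnion]
      · exact card_le_card (biUnion_subset.2 fun i _ => filter_subset _ _)
      · intro i _ j _ hij
        refine disjoint_left.2 fun p hp hp' => hij ?_
        exact (mem_filter.1 hp).2.symm.trans (mem_filter.1 hp').2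
  have := card_filter_add_card_filter_not (s := B) (fun p => p.1.1 = p.2.1)
  omega

/-- The toroidal grid is 4-edge-connected, and its only 4-edge cuts are those around a vertex: with
four boundary edges, `K` meets just one row and one column partially, so that membership in `K` is
constant away from their common vertex. -/
theorem four_le_card_outBoundary (hm : 3 ≤ m) (hn : 3 ≤ n) {K : Finset (Fin m × Fin n)}
    {a b : Fin m × Fin n} (ha : a ∈ K) (hb : b ∉ K) :
    4 ≤ (outBoundary (toroidalGrid m n) K).card ∧
      ((outBoundary (toroidalGrid m n) K).card ≤ 4 → K.card ≤ 1 ∨ Kᶜ.card ≤ 1) := by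
  classical
  have hbd := two_mul_card_rows_add_card_cols_le hm hn K
  set R := univ.filter fun i => ∃ y y', (i, y) ∈ K ∧ (i, y') ∉ K with hR
  set C := univ.filter fun j => ∃ x x', (x, j) ∈ K ∧ (x', j) ∉ K with hC
  have hrow : ∀ i ∉ R, ∀ y y', (i, y) ∈ K → (i, y') ∈ K := by
    intro i hi y y' h
    by_contra h'
    exact hi (mem_filter.2 ⟨mem_univ _, y, y', h, h'⟩)
  have hcol : ∀ j ∉ C, ∀ x x', (x, j) ∈ K → (x', j) ∈ K := by
    intro j hj x x' h
    by_contra h'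
    exact hj (mem_filter.2 ⟨mem_univ _, x, x', h, h'⟩)
  have hR0 : R.card = 0 → n ≤ C.card := by
    intro h
    rw [card_eq_zero] at h
    have hCu : C = univ := by
      refine eq_univ_iff_forall.2 fun j => mem_filter.2 ⟨mem_univ _, a.1, b.1, ?_, fun hj => hb ?_⟩
      · exact hrow _ (by simp [h]) a.2 _ ha
      · exact hrow _ (by simp [h]) j _ hj
    rw [hCu, card_univ, Fintype.card_fin]
  have hC0 : C.card = 0 → m ≤ R.card := by
    intro h
    rw [card_eq_zero] at h
    have hRu : R = univ := by
      refine eq_univ_iff_forall.2 fun i => mem_filter.2 ⟨mem_univ _, a.2, b.2, ?_, fun hi => hb ?_⟩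
      · exact hcol _ (by simp [h]) a.1 _ ha
      · exact hcol _ (by simp [h]) i _ hi
    rw [hRu, card_univ, Fintype.card_fin]
  refine ⟨by omega, fun h4 => ?_⟩
  obtain ⟨i, hi⟩ := card_eq_one.1 (show R.card = 1 by omega)
  obtain ⟨j, hj⟩ := card_eq_one.1 (show C.card = 1 by omega)
  have hrow' : ∀ x, x ≠ i → ∀ y y', (x, y) ∈ K → (x, y') ∈ K := fun x hx =>
    hrow x (by rw [hi]; simpa using hx)
  have hcol' : ∀ y, y ≠ j → ∀ x x', (x, y) ∈ K → (x', y) ∈ K := fun y hy =>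
    hcol y (by rw [hj]; simpa using hy)
  have hi1 := Fin.add_one_ne_self (by omega) i
  have hj1 := Fin.add_one_ne_self (by omega) j
  by_cases hin : (i + 1, j + 1) ∈ K
  · right
    refine card_le_one_iff_subset_singleton.2 ⟨(i, j), fun v hv => ?_⟩
    rw [mem_compl] at hv
    by_contra hne
    rw [mem_singleton, Prod.ext_iff, not_and_or] at hne
    rcases hne with hx | hy
    · exact hv (hrow' _ hx _ _ (hcol' _ hj1 _ v.1 hin))
    · exact hv (hcol' _ hy _ _ (hrow' _ hi1 _ v.2 hin))
  · left
    refine card_le_one_iff_subset_singleton.2 ⟨(i, j), fun v hv => ?_⟩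
    by_contra hne
    rw [mem_singleton, Prod.ext_iff, not_and_or] at hne
    rcases hne with hx | hy
    · exact hin (hcol' _ hj1 _ _ (hrow' _ hx _ (j + 1) hv))
    · exact hin (hrow' _ hi1 _ _ (hcol' _ hy _ (i + 1) hv))

/-- An independent set contains at most `(n - 1) / 2` vertices of each row, if `n` is odd. -/
theorem two_mul_card_add_le_of_independent (hm : 2 ≤ m) (hn : 2 ≤ n) (hno : Odd n)
    {S : Finset (Fin m × Fin n)} (hS : ∀ u ∈ S, ∀ v ∈ S, ¬ (toroidalGrid m n).Adj u v) :
    2 * S.card + m ≤ m * n := by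
  have hrow : ∀ i : Fin m, 2 * (S.filter fun v => v.1 = i).card + 1 ≤ n := by
    intro i
    have h1 : (S.filter fun v => v.1 = i).card = (univ.filter fun j => (i, j) ∈ S).card := by
      refine card_nbij' (fun v => v.2) (fun j => (i, j)) ?_ ?_ ?_ ?_
      · rintro ⟨x, y⟩ h
        obtain ⟨h', rfl⟩ := mem_filter.1 h
        exact mem_filter.2 ⟨mem_univ _, h'⟩
      · intro j h
        exact mem_filter.2 ⟨(mem_filter.1 h).2, rfl⟩
      · rintro ⟨x, y⟩ h
        obtain ⟨-, rfl⟩ := mem_filter.1 h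
        rfl
      · intro j h
        rfl
    set A := univ.filter fun j => (i, j) ∈ S with hA
    have h2 : Disjoint A (A.image (· + 1)) := by
      refine disjoint_left.2 fun j hj hj' => ?_
      obtain ⟨k, hk, rfl⟩ := mem_image.1 hj'
      refine hS _ (mem_filter.1 hk).2 _ (mem_filter.1 hj).2 ?_
      rw [toroidalGrid_adj hm hn]
      simp
    have h3 := card_union_of_disjoint h2
    rw [card_image_of_injective _ (add_left_injective 1)] at h3
    have h4 := card_le_univ (A ∪ A.image (· + 1))
    rw [Fintype.card_fin] at h4
    obtain ⟨k, hk⟩ := hno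
    omega
  have h1 := card_eq_sum_card_fiberwise (f := Prod.fst) (s := S) (t := univ)
    (fun _ _ => mem_coe.2 (mem_univ _))
  have h2 : ∑ i : Fin m, (2 * (S.filter fun v => v.1 = i).card + 1) ≤ ∑ _i : Fin m, n :=
    sum_le_sum fun i _ => hrow i
  rw [sum_add_distrib, ← mul_sum, ← h1] at h2
  simpa using h2

/-- Six edges do not suffice to separate the complement of a set `S` into `|S| + 3` parts. Each part
has at least four boundary edges, while at most `4 * |S|` edges meet `S`. So all these bounds are
attained: the parts are single vertices and `S` is an independent set with `2 * |S| + 3 = m * n`,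
but an independent set is not that large. -/
theorem not_barrier (hm : 5 ≤ m) (hn : 3 ≤ n) (hno : Odd n)
    {T : Finset (Sym2 (Fin m × Fin n))} (hT : T.card ≤ 6)
    {S : Finset (Fin m × Fin n)} {C : Type*} [Fintype C] {f : Fin m × Fin n → Option C}
    (hfS : ∀ v, f v = none ↔ v ∈ S) (hfC : ∀ c, ∃ v, f v = some c)
    (hfT : ∀ u v, (toroidalGrid m n).Adj u v → u ∉ S → v ∉ S → f u ≠ f v → s(u, v) ∈ T) :
    ¬ S.card + 3 ≤ Fintype.card C := by
  classical
  intro hSC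
  set G := toroidalGrid m n with hG
  let K : C → Finset (Fin m × Fin n) := fun c => univ.filter fun v => f v = some c
  have hK : ∀ c v, v ∈ K c ↔ f v = some c := fun c v => by simp [K]
  -- Ordered pairs from a part to `S`, from `S` to `S`, and across edges of `T`.
  let DS := univ.filter fun p : (Fin m × Fin n) × (Fin m × Fin n) =>
    G.Adj p.1 p.2 ∧ p.1 ∉ S ∧ p.2 ∈ S
  let DI := univ.filter fun p : (Fin m × Fin n) × (Fin m × Fin n) =>
    G.Adj p.1 p.2 ∧ p.1 ∈ S ∧ p.2 ∈ S
  let DT := univ.filter fun p : (Fin m × Fin n) × (Fin m × Fin n) => s(p.1, p.2) ∈ T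
  have hDT : DT.card ≤ 2 * T.card := by
    refine card_le_mul_card_image_of_maps_to
      (f := fun p : (Fin m × Fin n) × (Fin m × Fin n) => s(p.1, p.2)) (s := DT) (t := T)
      (fun p hp => (mem_filter.1 hp).2) 2 fun e _ => ?_
    induction e with
    | _ x y =>
      refine (card_le_card (t := {(x, y), (y, x)}) fun p hp => ?_).trans card_le_two
      have := (mem_filter.1 hp).2
      rw [Sym2.eq_iff] at this
      rw [mem_insert, mem_singleton]
      exact this.imp (fun h => Prod.ext h.1 h.2) fun h => Prod.ext h.1 h.2
  have hDS : DS.card + DI.card = 4 * S.card := by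
    have h1 : DS ∪ DI = S.biUnion fun w => (G.neighborFinset w).image fun v => (v, w) := by
      ext ⟨v, w⟩
      simp only [DS, DI, mem_union, mem_filter, mem_univ, true_and, mem_biUnion, mem_image,
        SimpleGraph.mem_neighborFinset, Prod.mk.injEq]
      constructor
      · rintro (h | h)
        · exact ⟨w, h.2.2, v, h.1.symm, rfl, rfl⟩
        · exact ⟨w, h.2.2, v, h.1.symm, rfl, rfl⟩
      · rintro ⟨_, hw, _, h, rfl, rfl⟩
        have := h.symm
        tauto
    have h2 : Disjoint DS DI :=
      disjoint_left.2 fun p hp hp' => (mem_filter.1 hp).2.2.1 (mem_filter.1 hp').2.2.1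
    rw [← card_union_of_disjoint h2, h1, card_biUnion, sum_congr rfl (g := fun _ => 4), sum_const,
      smul_eq_mul, mul_comm]
    · intro w _
      rw [card_image_of_injective _ fun a b h => (Prod.mk.inj h).1,
        SimpleGraph.card_neighborFinset_eq_degree]
      exact isRegularOfDegree_toroidalGrid (by omega) hn w
    · intro w _ w' _ hww
      refine disjoint_left.2 fun p hp hp' => hww ?_
      obtain ⟨v, -, rfl⟩ := mem_image.1 hp
      obtain ⟨v', -, h⟩ := mem_image.1 hp'
      exact (Prod.mk.inj h).2.symm
  have hsum : ∑ c, (outBoundary G (K c)).card ≤ DS.card + DT.card := by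
    rw [← card_biUnion]
    · refine (card_le_card (t := DS ∪ DT) (biUnion_subset.2 fun c _ p hp => ?_)).trans
        (card_union_le _ _)
      rw [mem_outBoundary, hK, hK] at hp
      obtain ⟨hadj, h1, h2⟩ := hp
      have h3 : p.1 ∉ S := by
        rw [← hfS, h1]
        simp
      rw [mem_union, mem_filter, mem_filter]
      by_cases h4 : p.2 ∈ S
      · exact Or.inl ⟨mem_univ _, hadj, h3, h4⟩
      · exact Or.inr ⟨mem_univ _, hfT _ _ hadj h3 h4 fun h => h2 (h ▸ h1)⟩
    · intro c _ c' _ hcc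
      refine disjoint_left.2 fun p hp hp' => hcc ?_
      rw [mem_outBoundary, hK] at hp hp'
      exact Option.some_injective _ (hp.2.1.symm.trans hp'.2.1)
  have hother : ∀ c : C, ∃ c' c'' : C, c' ≠ c ∧ c'' ≠ c ∧ c' ≠ c'' := by
    intro c
    have h1 : 1 < (univ.erase c).card := by
      rw [card_erase_of_mem (mem_univ _), card_univ]
      omega
    obtain ⟨c', hc', c'', hc'', h⟩ := one_lt_card.1 h1
    exact ⟨c', c'', ne_of_mem_erase hc', ne_of_mem_erase hc'', h⟩
  have hfour : ∀ c, 4 ≤ (outBoundary G (K c)).card ∧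
      ((outBoundary G (K c)).card ≤ 4 → (K c).card = 1) := by
    intro c
    obtain ⟨c', c'', h1, h2, h3⟩ := hother c
    obtain ⟨v, hv⟩ := hfC c
    obtain ⟨v', hv'⟩ := hfC c'
    obtain ⟨v'', hv''⟩ := hfC c''
    have hvK : v ∈ K c := (hK _ _).2 hv
    have hvK' : v' ∉ K c := fun h => h1 (Option.some_injective _ (hv'.symm.trans ((hK _ _).1 h)))
    have hvK'' : v'' ∉ K c := fun h => h2 (Option.some_injective _ (hv''.symm.trans ((hK _ _).1 h)))
    obtain ⟨h4, h5⟩ := four_le_card_outBoundary (by omega) hn hvK hvK'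
    refine ⟨h4, fun h => ?_⟩
    rcases h5 h with h6 | h6
    · exact le_antisymm h6 (card_pos.2 ⟨v, hvK⟩)
    · have := card_le_one.1 h6 v' (mem_compl.2 hvK') v'' (mem_compl.2 hvK'')
      subst this
      exact absurd (Option.some_injective _ (hv'.symm.trans hv'')) h3
  have hsum4 : ∑ _c : C, 4 ≤ ∑ c, (outBoundary G (K c)).card := sum_le_sum fun c _ => (hfour c).1
  have h4C : ∑ _c : C, 4 = 4 * Fintype.card C := by
    rw [sum_const, smul_eq_mul, mul_comm, card_univ]
  have heq : ∀ c, 4 = (outBoundary G (K c)).card := fun c =>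
    (sum_eq_sum_iff_of_le fun c _ => (hfour c).1).1 (by omega) c (mem_univ c)
  have hDI : DI = ∅ := card_eq_zero.1 (by omega)
  have hind := two_mul_card_add_le_of_independent (m := m) (n := n) (by omega) (by omega) hno
    (S := S) fun u hu v hv huv => by
      have : (u, v) ∈ DI := mem_filter.2 ⟨mem_univ _, huv, hu, hv⟩
      rw [hDI] at this
      exact absurd this (notMem_empty _)
  have hV : (univ : Finset (Fin m × Fin n)) = S ∪ univ.biUnion K := by
    refine (eq_univ_iff_forall.2 fun v => ?_).symm
    rw [mem_union, mem_biUnion, ← hfS]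
    cases h : f v with
    | none => exact Or.inl rfl
    | some c => exact Or.inr ⟨c, mem_univ _, (hK _ _).2 h⟩
  have hVc : m * n ≤ S.card + Fintype.card C := by
    have h1 := card_union_le S (univ.biUnion K)
    rw [← hV, card_univ] at h1
    have h2 : (univ.biUnion K).card ≤ ∑ c, (K c).card := card_biUnion_le
    rw [sum_congr rfl fun c _ => (hfour c).2 (heq c).ge] at h2
    simp at h1 h2
    omega
  omega

/-- Six edges never meet all near-perfect matchings, by Tutte's theorem for the graph without these
edges. -/
theorem IsTransversalSet.seven_le_card (hm : 5 ≤ m) (hn : 3 ≤ n) (hmo : Odd m) (hno : Odd n)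
    {T : Finset (Sym2 (Fin m × Fin n))} (hT : IsTransversalSet (toroidalGrid m n) 1 T) :
    7 ≤ T.card := by
  by_contra! hlt
  have hcard : Fintype.card (Fin m × Fin n) = m * n := by simp
  rcases exists_near_perfect_matching_or_barrier (H := (toroidalGrid m n).deleteEdges T)
    (by rw [hcard]; exact hmo.mul hno) with ⟨M, hM, hMc⟩ | ⟨S, C, hC, f, hS, hfC, hf, hSC⟩
  · have hM' : IsEdgeMatching (toroidalGrid m n) M :=
      ⟨fun e he => SimpleGraph.edgeSet_mono (SimpleGraph.deleteEdges_le _) (hM.1 e he), hM.2⟩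
    have h1 := hT.2 M ⟨hM', fun N hN => by
      have := hN.two_mul_card_le
      omega⟩
    obtain ⟨e, he⟩ := card_pos.1 h1
    obtain ⟨he, he'⟩ := mem_inter.1 he
    have := hM.1 e he'
    rw [SimpleGraph.edgeSet_deleteEdges] at this
    exact this.2 he
  · refine not_barrier hm hn hno (Nat.le_of_lt_succ hlt) hS hfC (fun u v huv hu hv hne => ?_) hSC
    by_contra hnot
    exact hne (hf u v ((SimpleGraph.deleteEdges_adj).2 ⟨huv, hnot⟩) hu hv)

end Boundary

/-! ### Independent sets and upper bounds -/

section UpperBound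

variable {m n : ℕ} [NeZero m] [NeZero n]

theorem card_le_two_mul_card_of_even (hm : 3 ≤ m) (hn : 3 ≤ n) (hme : Even m)
    {M : Finset (Sym2 (Fin m × Fin n))} (hM : IsMaximumMatching (toroidalGrid m n) M) :
    m * n ≤ 2 * M.card := by
  obtain ⟨cH, cV, hc⟩ := exists_colouring_of_even (n := n) hm hn hme
  obtain ⟨h1, h2⟩ := hc 0 (by omega)
  have := hM.2 _ h1.1
  omega

theorem card_le_two_mul_card_of_odd (hm : 3 ≤ m) (hn : 3 ≤ n) (hmo : Odd m) (hno : Odd n)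
    {M : Finset (Sym2 (Fin m × Fin n))} (hM : IsMaximumMatching (toroidalGrid m n) M) :
    m * n ≤ 2 * M.card + 1 := by
  obtain ⟨h1, h2⟩ := isMaximumMatching_odd hm hn hmo hno (p := 0) (q := 0) (by omega) (by omega)
    0 0 (k := 0) (by omega)
  have := hM.2 _ h1.1
  omega

/-- If the positions `φ i` move by one step from each row to the next, the sets
`φ i + {0, 2, 4, ...}`, without `φ i - 1`, form an independent set. It contains half of each row if
`n` is even, and half of each row minus one vertex if `n` is odd. -/
theorem exists_independent_of_walk (hm : 2 ≤ m) (hn : 2 ≤ n) {φ : Fin m → Fin n}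
    (hφ : ∀ i, φ (i + 1) = φ i + 1 ∨ φ i = φ (i + 1) + 1) :
    ∃ A : Finset (Fin m × Fin n), (∀ u ∈ A, ∀ v ∈ A, ¬ (toroidalGrid m n).Adj u v) ∧
      m * n ≤ 2 * A.card + m := by
  let t : Fin m × Fin n → Fin n := fun v => v.2 - φ v.1
  let A := univ.filter fun v => (t v).val % 2 = 0 ∧ (t v).val + 1 ≠ n
  have hA : ∀ v, v ∈ A ↔ (t v).val % 2 = 0 ∧ (t v).val + 1 ≠ n := fun v => by simp [A]
  have hstep : ∀ u ∈ A, ∀ v ∈ A, t u ≠ t v - 1 := by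
    intro u hu v hv h
    have h1 := Fin.val_sub_one_cases hn (t v)
    rw [← h] at h1
    rw [hA] at hu hv
    omega
  have hind : ∀ u ∈ A, ∀ v ∈ A, u.1 = v.1 ∧ v.2 = u.2 + 1 ∨ u.2 = v.2 ∧ v.1 = u.1 + 1 → False := by
    rintro ⟨x, y⟩ hu ⟨x', y'⟩ hv (⟨h, h'⟩ | ⟨h, h'⟩) <;> simp only at h h' <;> subst h h'
    · refine hstep _ hu _ hv ?_
      simp only [t]
      abel
    · rcases hφ x with h | h
      · refine hstep _ hv _ hu ?_
        simp only [t, h]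
        abel
      · refine hstep _ hu _ hv ?_
        simp only [t, h]
        abel
  refine ⟨A, fun u hu v hv huv => ?_, ?_⟩
  · rw [toroidalGrid_adj hm hn] at huv
    rcases huv with ⟨h, h' | h'⟩ | ⟨h, h' | h'⟩
    · exact hind u hu v hv (Or.inl ⟨h, h'⟩)
    · exact hind v hv u hu (Or.inl ⟨h.symm, h'⟩)
    · exact hind u hu v hv (Or.inr ⟨h, h'⟩)
    · exact hind v hv u hu (Or.inr ⟨h.symm, h'⟩)
  · -- Together with its translate in the rows, `A` covers all but one vertex of each row.
    let E := univ.filter fun v => (t v).val + 1 = n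
    have hE : E.card ≤ m := by
      have h1 : E.card ≤ (univ : Finset (Fin m)).card := by
        refine card_le_card_of_injOn Prod.fst (fun _ _ => mem_coe.2 (mem_univ _)) ?_
        rintro ⟨x, y⟩ hu ⟨x', y'⟩ hv h
        simp only at h
        subst h
        have hu' := (mem_filter.1 hu).2
        have hv' := (mem_filter.1 hv).2
        have : y - φ x = y' - φ x := Fin.ext (by simp only [t] at hu' hv'; omega)
        rw [sub_left_injective this]
      simpa using h1
    have hcover : (univ : Finset (Fin m × Fin n)) ⊆
        (A ∪ A.image fun v => (v.1, v.2 + 1)) ∪ E := by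
      rintro ⟨x, y⟩ -
      rw [mem_union, mem_union]
      by_cases hE' : (t (x, y)).val + 1 = n
      · exact Or.inr (mem_filter.2 ⟨mem_univ _, hE'⟩)
      · left
        by_cases hpar : (t (x, y)).val % 2 = 0
        · exact Or.inl ((hA _).2 ⟨hpar, hE'⟩)
        · right
          refine mem_image.2 ⟨(x, y - 1), (hA _).2 ?_, by simp⟩
          have h1 := Fin.val_sub_one_cases hn (t (x, y))
          have h2 : t (x, y - 1) = t (x, y) - 1 := by
            simp only [t]
            abel
          have h3 := (t (x, y)).2
          rw [h2]
          omega
    have h1 := card_le_card hcover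
    have h2 := card_union_le (A ∪ A.image fun v => (v.1, v.2 + 1)) E
    have h3 := card_union_le A (A.image fun v => (v.1, v.2 + 1))
    have h4 : (A.image fun v => (v.1, v.2 + 1)).card ≤ A.card := card_image_le
    rw [card_univ, Fintype.card_prod, Fintype.card_fin, Fintype.card_fin] at h1
    omega

theorem Fin.ofNat_add_one_eq {a b : ℕ} (h : a + 1 = b ∨ a + 1 = n ∧ b = 0) :
    Fin.ofNat n b = Fin.ofNat n a + 1 := by
  apply Fin.ext
  rcases h with rfl | ⟨h, rfl⟩
  · simp [Fin.val_add]
  · simp [Fin.val_add, h]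

/-- A walk on `ℕ`, taken modulo `n`, gives the positions for `exists_independent_of_walk`. -/
theorem exists_independent_of_nat_walk (hm : 2 ≤ m) (hn : 2 ≤ n) {g : ℕ → ℕ}
    (hg : ∀ i j, i < m → (i + 1 = j ∨ i + 1 = m ∧ j = 0) →
      (g i + 1 = g j ∨ g i + 1 = n ∧ g j = 0) ∨ g j + 1 = g i) :
    ∃ A : Finset (Fin m × Fin n), (∀ u ∈ A, ∀ v ∈ A, ¬ (toroidalGrid m n).Adj u v) ∧
      m * n ≤ 2 * A.card + m := by
  refine exists_independent_of_walk hm hn (φ := fun i => Fin.ofNat n (g i.val)) fun i => ?_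
  have h := Fin.val_sub_one_cases hm (i + 1)
  rw [add_sub_cancel_right] at h
  rcases hg i.val (i + 1).val i.2 (by omega) with h1 | h1
  · exact Or.inl (Fin.ofNat_add_one_eq h1)
  · exact Or.inr (Fin.ofNat_add_one_eq (Or.inl h1))

theorem exists_isTransversalSet_of_even (hm : 3 ≤ m) (hn : 3 ≤ n) (hme : Even m) {d : ℕ}
    (hd : 2 * d ≤ m * n) :
    ∃ T, IsTransversalSet (toroidalGrid m n) d T ∧ T.card ≤ 4 * d := by
  classical
  obtain ⟨A, hA, hAc⟩ := exists_independent_of_nat_walk (m := m) (n := n) (by omega) (by omega)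
    (g := fun i => i % 2) fun i j hi hj => by
      rw [Nat.even_iff] at hme
      omega
  have hcard : Fintype.card (Fin m × Fin n) = m * n := by simp
  have hreg := isRegularOfDegree_toroidalGrid (m := m) (n := n) hm hn
  obtain ⟨ν, hν⟩ : ∃ ν, m * n = ν + ν := hme.mul_right n
  have hmax : ∀ M, IsMaximumMatching (toroidalGrid m n) M → ν ≤ M.card := fun M hM => by
    have := card_le_two_mul_card_of_even hm hn hme hM
    omega
  have h3 : m * 3 ≤ m * n := Nat.mul_le_mul_left m hn
  by_cases h : d ≤ A.card
  · obtain ⟨B, hB, hBc⟩ := exists_subset_card_eq h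
    refine ⟨_, isTransversalSet_edgesMeeting (A := B) (ν := ν)
      (fun u hu v hv => hA u (hB hu) v (hB hv)) hmax (by omega), ?_⟩
    exact (card_edgesMeeting_le hreg B).trans_eq (by rw [hBc])
  · obtain ⟨B, hB, hBc⟩ := exists_subset_card_eq (show ν - d ≤ A.card by omega)
    obtain ⟨T, hT, hTc⟩ := exists_isTransversalSet_compl (d := d) hreg
      (fun u hu v hv => hA u (hB hu) v (hB hv)) hmax (by omega)
    exact ⟨T, hT, by omega⟩

theorem exists_isTransversalSet_of_odd_of_le (hm : 3 ≤ m) (hn : 3 ≤ n) (hmo : Odd m) (hno : Odd n)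
    (hnm : n ≤ m) {d : ℕ} (hd : m ≤ 2 * d + 1) (hd' : 2 * d + 1 ≤ m * n) :
    ∃ T, IsTransversalSet (toroidalGrid m n) d T ∧ T.card ≤ 4 * d + 2 := by
  classical
  -- The positions run once around the cycle of length `n` and then alternate between `0` and `1`.
  obtain ⟨A, hA, hAc⟩ := exists_independent_of_nat_walk (m := m) (n := n) (by omega) (by omega)
    (g := fun i => if i < n then i else (i + 1) % 2) fun i j hi hj => by
      rw [Nat.odd_iff] at hmo hno
      split_ifs <;> omega
  have hcard : Fintype.card (Fin m × Fin n) = m * n := by simp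
  have hreg := isRegularOfDegree_toroidalGrid (m := m) (n := n) hm hn
  obtain ⟨ν, hν⟩ := hmo.mul hno
  obtain ⟨B, hB, hBc⟩ := exists_subset_card_eq (show ν - d ≤ A.card by omega)
  obtain ⟨T, hT, hTc⟩ := exists_isTransversalSet_compl (d := d) (ν := ν) hreg
    (fun u hu v hv => hA u (hB hu) v (hB hv))
    (fun M hM => by have := card_le_two_mul_card_of_odd hm hn hmo hno hM; omega) (by omega)
  exact ⟨T, hT, by omega⟩

/-- The edges at `d + 1` independent vertices of one column; a maximum matching misses at most one
of these vertices. -/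
theorem exists_isTransversalSet_of_odd (hm : 3 ≤ m) (hn : 3 ≤ n) (hmo : Odd m) (hno : Odd n)
    {d : ℕ} (hd : 2 * d + 3 ≤ m) :
    ∃ T, IsTransversalSet (toroidalGrid m n) d T ∧ T.card ≤ 4 * (d + 1) := by
  classical
  let A : Finset (Fin m × Fin n) :=
    (univ : Finset (Fin (d + 1))).image fun k => (⟨2 * k.val, by have := k.2; omega⟩, 0)
  have hAc : A.card = d + 1 := by
    rw [card_image_of_injective, card_univ, Fintype.card_fin]
    intro k l h
    have := congrArg (fun v => v.1.val) h
    exact Fin.ext (by simpa using this)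
  have hA : ∀ u ∈ A, ∀ v ∈ A, ¬ (toroidalGrid m n).Adj u v := by
    intro u hu v hv huv
    obtain ⟨k, -, rfl⟩ := mem_image.1 hu
    obtain ⟨l, -, rfl⟩ := mem_image.1 hv
    have hk := k.2
    have hl := l.2
    have hn0 := Fin.add_one_ne_self (by omega) (0 : Fin n)
    rw [toroidalGrid_adj (by omega) (by omega)] at huv
    have key : ∀ x y : Fin m, x = y + 1 → y.val + 1 = x.val ∨ x.val = 0 ∧ y.val + 1 = m := by
      rintro x y rfl
      have := Fin.val_sub_one_cases (by omega) (y + 1)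
      rwa [add_sub_cancel_right] at this
    rcases huv with ⟨-, h | h⟩ | ⟨-, h | h⟩
    · exact hn0 h.symm
    · exact hn0 h.symm
    · have := key _ _ h
      simp only at this
      omega
    · have := key _ _ h
      simp only at this
      omega
  have hcard : Fintype.card (Fin m × Fin n) = m * n := by simp
  obtain ⟨ν, hν⟩ := hmo.mul hno
  refine ⟨_, isTransversalSet_edgesMeeting (d := d) (ν := ν) hA
    (fun M hM => by have := card_le_two_mul_card_of_odd hm hn hmo hno hM; omega) (by omega), ?_⟩
  exact (card_edgesMeeting_le (isRegularOfDegree_toroidalGrid hm hn) A).trans_eq (by rw [hAc])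

/-- The seven edges at two adjacent vertices. -/
theorem exists_isTransversalSet_one (hm : 3 ≤ m) (hn : 3 ≤ n) (hmo : Odd m) (hno : Odd n) :
    ∃ T, IsTransversalSet (toroidalGrid m n) 1 T ∧ T.card ≤ 7 := by
  classical
  have hreg := isRegularOfDegree_toroidalGrid (m := m) (n := n) hm hn
  let u : Fin m × Fin n := (0, 0)
  let v : Fin m × Fin n := (0, 0 + 1)
  have huv : (toroidalGrid m n).Adj u v := hEdge_mem_edgeSet (by omega) (by omega) u
  refine ⟨edgesMeeting (toroidalGrid m n) {u, v}, ⟨fun e he => (mem_edgesMeeting.1 he).1,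
    fun M hM => ?_⟩, ?_⟩
  · by_contra! h
    have h1 : Disjoint (M.biUnion Sym2.toFinset) {u, v} := by
      refine disjoint_left.2 fun w hw hw' => ?_
      obtain ⟨e, he, hwe⟩ := mem_biUnion.1 hw
      rw [Sym2.mem_toFinset] at hwe
      exact absurd (card_pos.2 ⟨e, mem_inter.2 ⟨mem_edgesMeeting.2
        ⟨hM.1.1 e he, w, hw', hwe⟩, he⟩⟩) (by omega)
    have h2 := card_le_univ (M.biUnion Sym2.toFinset ∪ {u, v})
    rw [card_union_of_disjoint h1, ← hM.1.two_mul_card_eq, card_pair huv.ne] at h2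
    have h3 := card_le_two_mul_card_of_odd hm hn hmo hno hM
    simp at h2
    omega
  · have h1 : edgesMeeting (toroidalGrid m n) {u, v} =
        (toroidalGrid m n).incidenceFinset u ∪ (toroidalGrid m n).incidenceFinset v := by
      simp [edgesMeeting, biUnion_insert]
    have h2 := card_union_add_card_inter ((toroidalGrid m n).incidenceFinset u)
      ((toroidalGrid m n).incidenceFinset v)
    have h3 : 0 < ((toroidalGrid m n).incidenceFinset u ∩
        (toroidalGrid m n).incidenceFinset v).card := by
      refine card_pos.2 ⟨s(u, v), ?_⟩
      rw [mem_inter, SimpleGraph.mem_incidenceFinset, SimpleGraph.mem_incidenceFinset]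
      exact ⟨⟨huv, by simp⟩, ⟨huv, by simp⟩⟩
    rw [SimpleGraph.card_incidenceFinset_eq_degree, SimpleGraph.card_incidenceFinset_eq_degree,
      hreg u, hreg v] at h2
    rw [h1]
    omega

end UpperBound

theorem transversalNumber_eq {V : Type*} [DecidableEq V] {G : SimpleGraph V} {d k : ℕ}
    (hex : ∃ T, IsTransversalSet G d T ∧ T.card ≤ k)
    (h : ∀ T, IsTransversalSet G d T → k ≤ T.card) : transversalNumber G d = k := by
  obtain ⟨T, hT, hTc⟩ := hex
  exact le_antisymm (hT.transversalNumber_le hTc) (le_transversalNumber ⟨T, hT⟩ h)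

theorem theorem4p9 (m n : ℕ) (hm : 3 ≤ m) (hn : 3 ≤ n) :
    (Even m → Even n → ∀ d : ℕ, 1 ≤ d → 2 * d ≤ m * n →
      transversalNumber (toroidalGrid m n) d = 4 * d) ∧
    (Even m → Odd n → ∀ d : ℕ, 1 ≤ d → 2 * d ≤ m * n →
      transversalNumber (toroidalGrid m n) d = 4 * d) ∧
    (Odd m → Odd n →
      (5 ≤ m → transversalNumber (toroidalGrid m n) 1 = 7) ∧
      (∀ d : ℕ, 2 ≤ d → 2 * d + 3 ≤ m →
        4 * d + 2 ≤ transversalNumber (toroidalGrid m n) d ∧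
        transversalNumber (toroidalGrid m n) d ≤ 5 * d + 2) ∧
      (n ≤ m → ∀ d : ℕ, m ≤ 2 * d + 1 → 2 * d + 1 ≤ m * n →
        transversalNumber (toroidalGrid m n) d = 4 * d + 2)) := by
  have : NeZero m := ⟨by omega⟩
  have : NeZero n := ⟨by omega⟩
  refine ⟨fun hme _ d _ hd => ?_, fun hme _ d _ hd => ?_, fun hmo hno =>
    ⟨fun hm5 => ?_, fun d hd hdm => ?_, fun hnm d hd hd' => ?_⟩⟩
  · exact transversalNumber_eq (exists_isTransversalSet_of_even hm hn hme hd)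
      fun T hT => hT.four_mul_le_of_even hm hn hme
  · exact transversalNumber_eq (exists_isTransversalSet_of_even hm hn hme hd)
      fun T hT => hT.four_mul_le_of_even hm hn hme
  · exact transversalNumber_eq (exists_isTransversalSet_one hm hn hmo hno)
      fun T hT => hT.seven_le_card hm5 hn hmo hno
  · obtain ⟨T, hT, hTc⟩ := exists_isTransversalSet_of_odd hm hn hmo hno hdm
    exact ⟨le_transversalNumber ⟨T, hT⟩
      fun T hT => hT.add_two_le_of_odd_of_odd hm hn hmo hno (by omega),
      hT.transversalNumber_le (by omega)⟩
  · exact transversalNumber_eq (exists_isTransversalSet_of_odd_of_le hm hn hmo hno hnm hd hd')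
      fun T hT => hT.add_two_le_of_odd_of_odd hm hn hmo hno (by omega)
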